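/- Let $\Omega\subset\mathbb R^3$ be a bounded open set of class $C^2$, $T>0$, $c_0\ge 0$, $V=H^1_0(\Omega)$, $\mathbf V=H^1_0(\Omega)^3$, with duals $V',\mathbf V'$, and let $(\cdot,\cdot)$ be the $L^2(\Omega)$ inner product. Let $k:\mathbb R\to\mathbb R$ be continuous with $0<k_1\le k(x)\le k_2$ for all $x\in\mathbb R$ and some constants $k_1,k_2$, and assume in addition that $k$ is globally Lipschitz. Let $\mathbf F\in L^2(0,T;L^2(\Omega)^3)\cap H^1(0,T;\mathbf V')$, $S\in L^2(0,T;V')$ and $d_0\in L^2(\Omega)$. For $\mathbf u,\mathbf w\in\mathbf V$ put $$e(\mathbf u,\mathbf w)=(\nabla\cdot\mathbf u,\nabla\cdot\mathbf w)+(\nabla\mathbf u,\nabla\mathbf w)+(\nabla\mathbf u,\nabla\mathbf w^T).$$ A pair $(\mathbf u,p)\in L^2(0,T;\mathbf V)\times L^2(0,T;V)$ is a weak solution if $\zeta=c_0p+\nabla\cdot\mathbf u\in L^2(0,T;L^2(\Omega))\cap H^1(0,T;V')$, if for all $\mathbf w\in L^2(0,T;\mathbf V)$ and $q\in L^2(0,T;V)$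 $$\int_0^T e(\mathbf u,\mathbf w)\,dt-\int_0^T(p,\nabla\cdot\mathbf w)\,dt=\int_0^T(\mathbf F,\mathbf w)\,dt,$$ $$\int_0^T(k(\zeta)\nabla p,\nabla q)\,dt+\int_0^T\langle\zeta_t,q\rangle_{V'\times V}\,dt=\int_0^T\langle S,q\rangle_{V'\times V}\,dt,$$ and if for every $q\in V$ the function $t\mapsto(\zeta(t),q)$ has an absolutely continuous representative on $[0,T]$ whose value at $t=0$ is $(d_0,q)$. Let $\mathcal W_T$ be the set of weak solutions $(\mathbf u,p)$ (for the given data) with $p_t\in L^2(0,T;L^2(\Omega))$. Suppose that $(\mathbf u,p)\in\mathcal W_T$ satisfies $p\in L^2(0,T;W^{1,\infty}(\Omega))$, that is, $p(t)\in W^{1,\infty}(\Omega)$ for almost every $t$ and $t\mapsto\|p(t)\|_{W^{1,\infty}(\Omega)}$ is in $L^2(0,T)$, and that at least one of the following holds: (a) $d_0=\nabla\cdot\mathbf u_0+c_0p_0$ for some $\mathbf u_0\in\mathbf V$ and $p_0\in L^2(\Omega)$; (b) $c_0>0$. Then $(\mathbf u,p)$ is the only element of $\mathcal W_T$: every $(\mathbf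 v,q)\in\mathcal W_T$ satisfies $\mathbf v(t)=\mathbf u(t)$ in $\mathbf V$ and $q(t)=p(t)$ in $V$ for almost every $t\in(0,T)$. -/

import Mathlib

open MeasureTheory Set
open scoped ContDiff NNReal ENNReal

noncomputable section

namespace Biot

/-- Three-dimensional Euclidean space. -/
abbrev E3 : Type := EuclideanSpace ℝ (Fin 3)

/-- A bounded open subset of `ℝ³` of class `C²`: near each boundary point there is a
`C²` diffeomorphism between open sets that carries `Ω` to the half space `{y | 0 < y 0}`. -/
structure IsC2Domain (Ω : Set E3) : Prop where
  isOpen : IsOpen Ω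
  isBounded : Bornology.IsBounded Ω
  boundary : ∀ x ∈ frontier Ω, ∃ ψ : OpenPartialHomeomorph E3 E3, x ∈ ψ.source ∧
    ContDiffOn ℝ 2 ψ ψ.source ∧ ContDiffOn ℝ 2 ψ.symm ψ.target ∧
    ψ '' (Ω ∩ ψ.source) = {y | 0 < y 0} ∩ ψ.target

/-! ### Function spaces on `Ω` -/

/-- `L²(Ω)`. -/
abbrev L2 (Ω : Set E3) : Type := Lp ℝ 2 (volume.restrict Ω)

/-- `L²(Ω)³`. -/
abbrev L2Vec (Ω : Set E3) : Type := PiLp 2 (fun _ : Fin 3 => L2 Ω)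

/-- The pairs `(φ, ∇φ)` with `φ ∈ C_c^∞(Ω)`, as a subspace of `L²(Ω) × L²(Ω)³`. The norm of the
ambient space restricts to the `H¹(Ω)` norm of `φ`. -/
def testPairs (Ω : Set E3) : Submodule ℝ (WithLp 2 (L2 Ω × L2Vec Ω)) where
  carrier := {v | ∃ φ : E3 → ℝ, ContDiff ℝ ∞ φ ∧ HasCompactSupport φ ∧ tsupport φ ⊆ Ω ∧
    v.fst =ᵐ[volume.restrict Ω] φ ∧
    ∀ i : Fin 3, v.snd i =ᵐ[volume.restrict Ω]
      fun x => fderiv ℝ φ x (EuclideanSpace.single i 1)}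
  add_mem' := by
    rintro v w ⟨φ, h1, h2, h3, h4, h5⟩ ⟨ψ, k1, k2, k3, k4, k5⟩
    refine ⟨φ + ψ, h1.add k1, h2.add k2,
      (tsupport_add φ ψ).trans (union_subset h3 k3), ?_, fun i => ?_⟩
    · filter_upwards [h4, k4, Lp.coeFn_add v.fst w.fst] with x a b c
      simp only [WithLp.add_fst]
      rw [c, Pi.add_apply, Pi.add_apply, a, b]
    · filter_upwards [h5 i, k5 i, Lp.coeFn_add (v.snd i) (w.snd i)] with x a b c
      simp only [WithLp.add_snd, PiLp.add_apply]
      rw [c, Pi.add_apply, a, b,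
        fderiv_add (h1.differentiable (by simp) x) (k1.differentiable (by simp) x)]
      rfl
  zero_mem' := by
    refine ⟨0, contDiff_const, HasCompactSupport.zero, by simp [tsupport], ?_, fun i => ?_⟩
    · exact Lp.coeFn_zero _ _ _
    · filter_upwards [Lp.coeFn_zero ℝ 2 (volume.restrict Ω)] with x a
      simp only [WithLp.zero_snd, PiLp.zero_apply]
      rw [a]
      simp
  smul_mem' := by
    rintro c v ⟨φ, h1, h2, h3, h4, h5⟩
    refine ⟨c • φ, h1.const_smul c, h2.smul_left (f := fun _ => c),
      (tsupport_smul_subset_right (fun _ => c) φ).trans h3, ?_, fun i => ?_⟩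
    · filter_upwards [h4, Lp.coeFn_smul c v.fst] with x a b
      simp only [WithLp.smul_fst]
      rw [b, Pi.smul_apply, Pi.smul_apply, a]
    · filter_upwards [h5 i, Lp.coeFn_smul c (v.snd i)] with x a b
      simp only [WithLp.smul_snd, PiLp.smul_apply]
      rw [b, Pi.smul_apply, a, fderiv_const_smul (h1.differentiable (by simp) x)]
      rfl

/-- `V = H¹₀(Ω)`, the closure of `C_c^∞(Ω)` in the `H¹` norm; an element is carried together
with its weak gradient. -/
def H10 (Ω : Set E3) : Type := (testPairs Ω).topologicalClosure

instance (Ω : Set E3) : NormedAddCommGroup (H10 Ω) :=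
  inferInstanceAs (NormedAddCommGroup (testPairs Ω).topologicalClosure)

instance (Ω : Set E3) : InnerProductSpace ℝ (H10 Ω) :=
  inferInstanceAs (InnerProductSpace ℝ (testPairs Ω).topologicalClosure)

instance (Ω : Set E3) : CompleteSpace (H10 Ω) :=
  inferInstanceAs (CompleteSpace (testPairs Ω).topologicalClosure)

/-- The map `v ↦ (v, ∇v)` from `H¹₀(Ω)` to `L²(Ω) × L²(Ω)³`. -/
def graph (Ω : Set E3) : H10 Ω →L[ℝ] WithLp 2 (L2 Ω × L2Vec Ω) :=
  (testPairs Ω).topologicalClosure.subtypeL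

/-- `𝐕 = H¹₀(Ω)³`. -/
abbrev H10Vec (Ω : Set E3) : Type := PiLp 2 (fun _ : Fin 3 => H10 Ω)

/-- The inclusion `H¹₀(Ω) → L²(Ω)`. -/
def val (Ω : Set E3) : H10 Ω →L[ℝ] L2 Ω :=
  (WithLp.fstL 2 ℝ (L2 Ω) (L2Vec Ω)).comp (graph Ω)

/-- The weak partial derivative `∂ᵢ : H¹₀(Ω) → L²(Ω)`. -/
def pd (Ω : Set E3) (i : Fin 3) : H10 Ω →L[ℝ] L2 Ω :=
  (PiLp.proj 2 (fun _ : Fin 3 => L2 Ω) i).comp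
    ((WithLp.sndL 2 ℝ (L2 Ω) (L2Vec Ω)).comp (graph Ω))

/-- The `i`-th component `𝐕 → V`. -/
def comp (Ω : Set E3) (i : Fin 3) : H10Vec Ω →L[ℝ] H10 Ω :=
  PiLp.proj 2 (fun _ : Fin 3 => H10 Ω) i

/-- The divergence `𝐕 → L²(Ω)`. -/
def dvg (Ω : Set E3) : H10Vec Ω →L[ℝ] L2 Ω :=
  ∑ i : Fin 3, (pd Ω i).comp (comp Ω i)

/-- The elasticity form
`e(u, w) = (∇·u, ∇·w) + (∇u, ∇w) + (∇u, ∇wᵀ)`, with `(∇u)ᵢⱼ = ∂ⱼuᵢ`. -/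
def elast {Ω : Set E3} (u w : H10Vec Ω) : ℝ :=
  inner ℝ (dvg Ω u) (dvg Ω w)
    + ∑ i : Fin 3, ∑ j : Fin 3, inner ℝ (pd Ω j (u i)) (pd Ω j (w i))
    + ∑ i : Fin 3, ∑ j : Fin 3, inner ℝ (pd Ω j (u i)) (pd Ω i (w j))

/-- `L²(Ω) ⊂ V'`: the functional `q ↦ (f, q)_{L²(Ω)}`. -/
def toDual {Ω : Set E3} (f : L2 Ω) : StrongDual ℝ (H10 Ω) :=
  (innerSL ℝ f).comp (val Ω)

/-- `L²(Ω)³ ⊂ 𝐕'`: the functional `w ↦ (F, w)_{L²(Ω)³}`. -/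
def toDualVec {Ω : Set E3} (F : L2Vec Ω) : StrongDual ℝ (H10Vec Ω) :=
  ∑ i : Fin 3, (innerSL ℝ (F i)).comp ((val Ω).comp (comp Ω i))

/-- The `W^{1,∞}(Ω)` norm (possibly `∞`) of an element of `H¹₀(Ω)`. -/
def w1InfNorm {Ω : Set E3} (p : H10 Ω) : ℝ≥0∞ :=
  eLpNorm (val Ω p) ⊤ (volume.restrict Ω)
    + ∑ i : Fin 3, eLpNorm (pd Ω i p) ⊤ (volume.restrict Ω)

/-! ### Functions of time -/

/-- Lebesgue measure on `(0, T)`. -/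
abbrev timeMeasure (T : ℝ) : Measure ℝ := volume.restrict (Ioo 0 T)

/-- `f ∈ L²(0, T; X)`, in the sense of Bochner. -/
abbrev MemL2Time {X : Type*} [NormedAddCommGroup X] (T : ℝ) (f : ℝ → X) : Prop :=
  MemLp f 2 (timeMeasure T)

/-- `g` is the derivative of `f` in the sense of `X`-valued distributions on `(0, T)`. -/
def HasWeakTimeDeriv {X : Type*} [NormedAddCommGroup X] [NormedSpace ℝ X]
    (T : ℝ) (f g : ℝ → X) : Prop :=
  ∀ φ : ℝ → ℝ, ContDiff ℝ ∞ φ → HasCompactSupport φ → tsupport φ ⊆ Ioo 0 T →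
    ∫ t, deriv φ t • f t ∂timeMeasure T = - ∫ t, φ t • g t ∂timeMeasure T

/-- `f` has a weak derivative `f_t ∈ L²(0, T; X)`. -/
def WeakTimeDerivInL2 {X : Type*} [NormedAddCommGroup X] [NormedSpace ℝ X]
    (T : ℝ) (f : ℝ → X) : Prop :=
  ∃ g : ℝ → X, MemL2Time T g ∧ HasWeakTimeDeriv T f g

/-- `f ∈ H¹(0, T; X)`. -/
def MemH1Time {X : Type*} [NormedAddCommGroup X] [NormedSpace ℝ X]
    (T : ℝ) (f : ℝ → X) : Prop :=
  MemL2Time T f ∧ WeakTimeDerivInL2 T f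

/-- `p ∈ L²(0, T; W^{1,∞}(Ω))` for an `H¹₀(Ω)`-valued `p`: almost every `p t` lies in `W^{1,∞}(Ω)`
and the norm is square integrable in time. Strong measurability with values in the
non-separable space `W^{1,∞}(Ω)` is not asked for. -/
def MemL2W1Inf {Ω : Set E3} (T : ℝ) (p : ℝ → H10 Ω) : Prop :=
  (∀ᵐ t ∂timeMeasure T, w1InfNorm (p t) < ⊤) ∧
    MemL2Time T (fun t => (w1InfNorm (p t)).toReal)

/-! ### The nonlinear poroelastic system -/

/-- The permeability is continuous and bounded between two positive constants. -/
def PermeabilityBounds (k : ℝ → ℝ) : Prop :=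
  Continuous k ∧ ∃ k₁ k₂ : ℝ, 0 < k₁ ∧ 0 < k₂ ∧ ∀ x, k₁ ≤ k x ∧ k x ≤ k₂

/-- The form `(k(z) ∇p, ∇q)_{L²(Ω)}`. -/
def diffusion {Ω : Set E3} (k : ℝ → ℝ) (z : L2 Ω) (p q : H10 Ω) : ℝ :=
  ∫ x in Ω, k (z x) * ∑ i : Fin 3, pd Ω i p x * pd Ω i q x

/-- The fluid content `ζ = c₀ p + ∇·u`. -/
def fluidContent {Ω : Set E3} (c₀ : ℝ) (u : H10Vec Ω) (p : H10 Ω) : L2 Ω :=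
  c₀ • val Ω p + dvg Ω u

/-- `(u, p)` is a weak solution on `[0, T]` of
`-∇·[2ε(u) + (∇·u)I - pI] = F`, `ζ_t - ∇·[k(ζ)∇p] = S`, `ζ = c₀p + ∇·u`, with homogeneous
Dirichlet conditions for `u` and `p`, and `ζ(0) = d₀`. -/
structure IsWeakSolution {Ω : Set E3} (T c₀ : ℝ) (k : ℝ → ℝ) (F : ℝ → L2Vec Ω)
    (S : ℝ → StrongDual ℝ (H10 Ω)) (d₀ : L2 Ω) (u : ℝ → H10Vec Ω) (p : ℝ → H10 Ω) : Prop where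
  memL2_u : MemL2Time T u
  memL2_p : MemL2Time T p
  elasticity : ∀ w : ℝ → H10Vec Ω, MemL2Time T w →
    (∫ t, elast (u t) (w t) ∂timeMeasure T)
        - ∫ t, inner ℝ (val Ω (p t)) (dvg Ω (w t)) ∂timeMeasure T
      = ∫ t, ∑ i : Fin 3, inner ℝ (F t i) (val Ω (w t i)) ∂timeMeasure T
  pressure : ∃ ζ' : ℝ → StrongDual ℝ (H10 Ω), MemL2Time T ζ' ∧
    HasWeakTimeDeriv T (fun t => toDual (fluidContent c₀ (u t) (p t))) ζ' ∧
    ∀ q : ℝ → H10 Ω, MemL2Time T q →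
      (∫ t, diffusion k (fluidContent c₀ (u t) (p t)) (p t) (q t) ∂timeMeasure T)
          + ∫ t, ζ' t (q t) ∂timeMeasure T
        = ∫ t, S t (q t) ∂timeMeasure T
  /-- `t ↦ (ζ(t), q)` has an absolutely continuous representative on `[0, T]`, with value
  `(d₀, q)` at `t = 0`. -/
  initial : ∀ q : H10 Ω, ∃ g : ℝ → ℝ, AbsolutelyContinuousOnInterval g 0 T ∧
    (∀ᵐ t ∂timeMeasure T, g t = inner ℝ (fluidContent c₀ (u t) (p t)) (val Ω q)) ∧
    g 0 = inner ℝ d₀ (val Ω q)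

/-- The class `𝒲_T` of weak solutions with `p_t ∈ L²(0, T; L²(Ω))`. -/
def classW {Ω : Set E3} (T c₀ : ℝ) (k : ℝ → ℝ) (F : ℝ → L2Vec Ω)
    (S : ℝ → StrongDual ℝ (H10 Ω)) (d₀ : L2 Ω) : Set ((ℝ → H10Vec Ω) × (ℝ → H10 Ω)) :=
  {s | IsWeakSolution T c₀ k F S d₀ s.1 s.2 ∧ WeakTimeDerivInL2 T (fun t => val Ω (s.2 t))}

end Biot

end

open Biot

open Filter Topology

/-! ### Absolutely continuous functions of one variable -/

section Calculus

variable {X Y Z : Type*} [NormedAddCommGroup X] [NormedSpace ℝ X]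
  [NormedAddCommGroup Y] [NormedSpace ℝ Y] [NormedAddCommGroup Z] [NormedSpace ℝ Z]

/-! Let P and U be the differences of the pressures and of the displacements. The elasticity
equation is linear and its form is coercive, so U is the displacement caused by P. The fluid
contents therefore differ by BP, where B = `storage` is bounded, symmetric and nonnegative on L²(Ω).
The displacement is thereby eliminated.

Since P_t lies in L²(0,T; L²), testing the difference of the pressure equations with P gives half
the time derivative of the energy (BP, P), plus the difference of the diffusion terms, equal to
zero. That difference splits into a weighted |∇P|² term and a term with k(ζ₂) − k(ζ₁) multiplied by
the gradient of the solution assumed bounded. The Lipschitz bound and Young's inequality bound the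
latter by half of the former plus a multiple of N(t)² ‖BP‖², where N is the W^{1,∞} norm
(`le_diffusion_sub_diffusion`).

The decisive estimate is `norm_storage_sq_le`: ‖BP‖² is at most a multiple of (BP, P), even for c₀ =
0, where the energy need not control P itself. Grönwall's lemma with integrable coefficient N² and
zero initial energy (`IsWeakSolution.inner_storage_initial_eq_zero`) makes the energy vanish. The
retained gradient term then vanishes too, so Poincaré's inequality gives P = 0, and U = 0 follows.
-/

theorem AbsolutelyContinuousOnInterval.of_dist_le {X Y : Type*} [PseudoMetricSpace X]
    [PseudoMetricSpace Y] {f : ℝ → X} {g : ℝ → Y} {a b : ℝ}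
    (hg : AbsolutelyContinuousOnInterval g a b)
    (h : ∀ x ∈ uIcc a b, ∀ y ∈ uIcc a b, dist (f x) (f y) ≤ dist (g x) (g y)) :
    AbsolutelyContinuousOnInterval f a b := by
  rw [absolutelyContinuousOnInterval_iff] at hg ⊢
  intro ε hε
  obtain ⟨δ, hδ, H⟩ := hg ε hε
  refine ⟨δ, hδ, fun E hE hlen => lt_of_le_of_lt (Finset.sum_le_sum fun i hi => ?_) (H E hE hlen)⟩
  exact h _ (hE.1 i hi).1 _ (hE.1 i hi).2

/-- Increments of the primitive are dominated by those of the primitive of ‖g‖, which reduces the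
claim to the scalar case. -/
theorem IntervalIntegrable.absolutelyContinuousOnInterval_primitive {g : ℝ → X} {a b : ℝ}
    (hg : IntervalIntegrable g volume a b) :
    AbsolutelyContinuousOnInterval (fun x => ∫ v in a..x, g v) a b := by
  refine (hg.norm.absolutelyContinuousOnInterval_intervalIntegral
    (left_mem_uIcc (a := a) (b := b))).of_dist_le fun x hx y hy => ?_
  have hsub : ∀ z ∈ uIcc a b, IntervalIntegrable g volume a z := fun z hz =>
    hg.mono_set (uIcc_subset_uIcc left_mem_uIcc hz)
  rw [dist_eq_norm, dist_eq_norm, intervalIntegral.integral_interval_sub_left (hsub x hx) (hsub y hy),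
    intervalIntegral.integral_interval_sub_left (hsub x hx).norm (hsub y hy).norm, Real.norm_eq_abs]
  exact intervalIntegral.norm_integral_le_abs_integral_norm

theorem AbsolutelyContinuousOnInterval.const_add {X : Type*} [NormedAddCommGroup X]
    {f : ℝ → X} {a b : ℝ}
    (hf : AbsolutelyContinuousOnInterval f a b) (c : X) :
    AbsolutelyContinuousOnInterval (fun x => c + f x) a b :=
  hf.of_dist_le fun x _ y _ => by simp

theorem AbsolutelyContinuousOnInterval.bilin (M : X →L[ℝ] Y →L[ℝ] Z) {f : ℝ → X} {g : ℝ → Y}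
    {a b : ℝ} (hf : AbsolutelyContinuousOnInterval f a b)
    (hg : AbsolutelyContinuousOnInterval g a b) :
    AbsolutelyContinuousOnInterval (fun x => M (f x) (g x)) a b := by
  obtain ⟨C, hC⟩ := hf.exists_bound
  obtain ⟨D, hD⟩ := hg.exists_bound
  unfold AbsolutelyContinuousOnInterval at hf hg ⊢
  refine squeeze_zero' (Eventually.of_forall fun _ => Finset.sum_nonneg fun i _ => dist_nonneg) ?_
    (by simpa using (hg.const_mul (‖M‖ * C)).add (hf.const_mul (‖M‖ * D)))
  rw [eventually_inf_principal]
  filter_upwards with E hE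
  rw [Finset.mul_sum, Finset.mul_sum, ← Finset.sum_add_distrib]
  refine Finset.sum_le_sum fun i hi => ?_
  have h1 := hC _ (hE.1 i hi).1
  have h2 := hD _ (hE.1 i hi).2
  set x := (E.2 i).1
  set y := (E.2 i).2
  rw [dist_eq_norm, dist_eq_norm, dist_eq_norm]
  have : M (f x) (g x) - M (f y) (g y) = M (f x) (g x - g y) + M (f x - f y) (g y) := by
    simp
  rw [this]
  refine (norm_add_le _ _).trans (add_le_add ?_ ?_)
  · refine (M.le_opNorm₂ _ _).trans ?_
    gcongr
  · refine (M.le_opNorm₂ _ _).trans ?_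
    rw [mul_assoc, mul_assoc, mul_comm ‖f x - f y‖]
    gcongr

/-- The fundamental theorem of calculus for vector valued absolutely continuous functions with an
almost everywhere derivative. -/
theorem AbsolutelyContinuousOnInterval.integral_eq_sub_of_ae_hasDerivAt [CompleteSpace X]
    {f f' : ℝ → X} {a b : ℝ} (hf : AbsolutelyContinuousOnInterval f a b)
    (hf' : IntervalIntegrable f' volume a b)
    (h : ∀ᵐ x, x ∈ uIcc a b → HasDerivAt f (f' x) x) :
    ∫ x in a..b, f' x = f b - f a := by
  -- Subtracting the primitive of `f'` leaves an absolutely continuous function with zero derivative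
  -- almost everywhere, hence a constant.
  have hd : ∀ᵐ x, x ∈ uIcc a b →
      HasDerivAt (fun x => f x - ∫ t in a..x, f' t) 0 x := by
    filter_upwards [h, hf'.ae_hasDerivAt_integral] with x h1 h2 hx
    simpa using (h1 hx).fun_sub (h2 hx a left_mem_uIcc)
  obtain ⟨C, hC⟩ :=
    (hf.fun_sub hf'.absolutelyContinuousOnInterval_primitive).const_of_ae_hasDerivAt_zero hd
  have ha := hC a left_mem_uIcc
  have hb := hC b right_mem_uIcc
  simp only [intervalIntegral.integral_same, sub_zero] at ha
  rw [← ha] at hb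
  rw [← hb]
  abel

theorem ae_hasDerivAt_const_add_integral [CompleteSpace X] {g : ℝ → X} {a b : ℝ} (c : X)
    (hg : IntervalIntegrable g volume a b) :
    ∀ᵐ x, x ∈ uIcc a b → HasDerivAt (fun t => c + ∫ s in a..t, g s) (g x) x := by
  filter_upwards [hg.ae_hasDerivAt_integral] with x h hx
  exact (h hx a left_mem_uIcc).const_add c

theorem IntervalIntegrable.bilin_continuousOn (M : X →L[ℝ] Y →L[ℝ] Z) {f : ℝ → X} {g : ℝ → Y}
    {a b : ℝ} (hf : IntervalIntegrable f volume a b) (hg : ContinuousOn g (uIcc a b)) :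
    IntervalIntegrable (fun x => M (f x) (g x)) volume a b := by
  obtain ⟨C, hC⟩ := isCompact_uIcc.exists_bound_of_continuousOn hg
  have hgm : AEStronglyMeasurable g (volume.restrict (uIoc a b)) :=
    (hg.mono uIoc_subset_uIcc).aestronglyMeasurable measurableSet_uIoc
  rw [intervalIntegrable_iff] at hf ⊢
  refine (hf.norm.const_mul (‖M‖ * C)).mono' (M.aestronglyMeasurable_comp₂ hf.1 hgm) ?_
  filter_upwards [ae_restrict_mem measurableSet_uIoc] with x hx
  refine (M.le_opNorm₂ _ _).trans ?_
  have := hC x (uIoc_subset_uIcc hx)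
  rw [mul_assoc, mul_assoc, mul_comm ‖f x‖]
  gcongr

/-- The product rule in integrated form, for primitives of integrable functions. -/
theorem integral_bilin_primitive [CompleteSpace X] [CompleteSpace Y] [CompleteSpace Z]
    (M : X →L[ℝ] Y →L[ℝ] Z) {f : ℝ → X} {g : ℝ → Y} {f' : ℝ → X} {g' : ℝ → Y} {a b : ℝ}
    (hf : AbsolutelyContinuousOnInterval f a b) (hg : AbsolutelyContinuousOnInterval g a b)
    (hf' : IntervalIntegrable f' volume a b) (hg' : IntervalIntegrable g' volume a b)
    (hfd : ∀ᵐ x, x ∈ uIcc a b → HasDerivAt f (f' x) x)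
    (hgd : ∀ᵐ x, x ∈ uIcc a b → HasDerivAt g (g' x) x) :
    IntervalIntegrable (fun x => M (f' x) (g x)) volume a b ∧
    IntervalIntegrable (fun x => M (f x) (g' x)) volume a b ∧
    (∫ x in a..b, M (f' x) (g x)) + ∫ x in a..b, M (f x) (g' x) = M (f b) (g b) - M (f a) (g a) := by
  have i1 := hf'.bilin_continuousOn M hg.continuousOn
  have i2 := hg'.bilin_continuousOn M.flip hf.continuousOn
  simp only [ContinuousLinearMap.flip_apply] at i2
  refine ⟨i1, i2, ?_⟩
  rw [← intervalIntegral.integral_add i1 i2]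
  refine (hf.bilin M hg).integral_eq_sub_of_ae_hasDerivAt (i1.add i2) ?_
  filter_upwards [hfd, hgd] with x h1 h2 hx
  have := (M.hasFDerivAt_of_bilinear (h1 hx).hasFDerivAt (h2 hx).hasFDerivAt).hasDerivAt
  simpa [add_comm] using this

/-- Grönwall's lemma in integral form, with an integrable coefficient and zero initial value. -/
theorem eq_zero_of_le_integral_mul {E a : ℝ → ℝ} {T : ℝ} (hT : 0 ≤ T)
    (hE : ContinuousOn E (Icc 0 T)) (hE0 : ∀ t ∈ Icc 0 T, 0 ≤ E t)
    (ha : IntervalIntegrable a volume 0 T) (ha0 : ∀ t, 0 ≤ a t)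
    (h : ∀ t ∈ Icc 0 T, E t ≤ ∫ s in (0)..t, a s * E s) :
    ∀ t ∈ Icc 0 T, E t = 0 := by
  have hu : uIcc 0 T = Icc 0 T := uIcc_of_le hT
  have haE : IntervalIntegrable (fun s => a s * E s) volume 0 T :=
    ha.mul_continuousOn (by rwa [hu])
  set A : ℝ → ℝ := fun t => ∫ s in (0)..t, a s
  set Φ : ℝ → ℝ := fun t => ∫ s in (0)..t, a s * E s
  have hA : AbsolutelyContinuousOnInterval A 0 T := ha.absolutelyContinuousOnInterval_primitive
  have hΦ : AbsolutelyContinuousOnInterval Φ 0 T := haE.absolutelyContinuousOnInterval_primitive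
  have hAnn : ∀ t ∈ Icc 0 T, 0 ≤ A t := fun t ht =>
    intervalIntegral.integral_nonneg ht.1 fun s _ => ha0 s
  -- As `A` is nonnegative and r ↦ exp(−r) is 1-Lipschitz for r ≥ 0, absolute continuity passes from
  -- `A` to the integrating factor.
  have hexp : AbsolutelyContinuousOnInterval (fun t => Real.exp (-A t)) 0 T := by
    refine hA.of_dist_le fun x hx y hy => ?_
    rw [hu] at hx hy
    have aux : ∀ r s : ℝ, 0 ≤ r → r ≤ s → |Real.exp (-r) - Real.exp (-s)| ≤ |r - s| := by
      intro r s hr hrs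
      have h1 : Real.exp (-s) = Real.exp (-r) * Real.exp (-(s - r)) := by
        rw [← Real.exp_add]; congr 1; ring
      have h2 := Real.add_one_le_exp (-(s - r))
      have h3 : Real.exp (-r) ≤ 1 := Real.exp_le_one_iff.2 (by linarith)
      have h4 := Real.exp_pos (-r)
      have h5 : Real.exp (-s) ≤ Real.exp (-r) := Real.exp_le_exp.2 (by linarith)
      rw [abs_of_nonneg (by linarith), abs_sub_comm, abs_of_nonneg (by linarith)]
      nlinarith
    rw [Real.dist_eq, Real.dist_eq]
    rcases le_total (A x) (A y) with hxy | hxy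
    · exact aux _ _ (hAnn x hx) hxy
    · rw [abs_sub_comm, abs_sub_comm (A x)]
      exact aux _ _ (hAnn y hy) hxy
  have hΨ := hΦ.fun_mul hexp
  intro t ht
  have htu : uIcc 0 t ⊆ uIcc 0 T := uIcc_subset_uIcc left_mem_uIcc (by rwa [hu])
  -- The derivative is a(E − Φ)exp(−A) almost everywhere, which is nonpositive because E ≤ Φ.
  have hneg : ∫ x in (0)..t, deriv (fun t => Φ t * Real.exp (-A t)) x ≤ 0 := by
    rw [← neg_nonneg, ← intervalIntegral.integral_neg]
    refine intervalIntegral.integral_nonneg_of_ae_restrict ht.1 ?_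
    have hae : ∀ᵐ x, x ∈ Icc 0 t → 0 ≤ -deriv (fun t => Φ t * Real.exp (-A t)) x := by
      filter_upwards [ha.ae_hasDerivAt_integral, haE.ae_hasDerivAt_integral] with x h1 h2 hx
      have hx' : x ∈ uIcc 0 T := htu (by rwa [uIcc_of_le ht.1])
      have d1 : HasDerivAt A (a x) x := h1 hx' 0 left_mem_uIcc
      have d2 : HasDerivAt Φ (a x * E x) x := h2 hx' 0 left_mem_uIcc
      rw [(d2.fun_mul d1.fun_neg.exp).deriv]
      have h3 := h x (by rwa [hu] at hx')
      have h4 := mul_le_mul_of_nonneg_left h3 (ha0 x)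
      have h5 := Real.exp_pos (-A x)
      have : 0 ≤ (a x * Φ x - a x * E x) * Real.exp (-A x) :=
        mul_nonneg (sub_nonneg.2 h4) h5.le
      linarith
    exact (ae_restrict_iff' measurableSet_Icc).2 hae
  rw [(hΨ.mono htu).integral_deriv_eq_sub] at hneg
  have h0 : Φ 0 = 0 := intervalIntegral.integral_same
  rw [h0, zero_mul, sub_zero] at hneg
  have h1 : Φ t ≤ 0 := by
    by_contra hlt
    exact absurd (mul_pos (not_le.1 hlt) (Real.exp_pos (-A t))) (not_lt.2 hneg)
  exact le_antisymm ((h t ht).trans h1) (hE0 t ht)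

end Calculus

namespace Biot

/-! ### Weak time derivatives -/

section WeakTimeDeriv

variable {X Y : Type*} [NormedAddCommGroup X] [NormedSpace ℝ X] [NormedAddCommGroup Y]
  [NormedSpace ℝ Y] {T : ℝ}

theorem MemL2Time.integrable {Y : Type*} [NormedAddCommGroup Y] {f : ℝ → Y}
    (hf : MemL2Time T f) : Integrable f (timeMeasure T) :=
  MemLp.integrable (by norm_num) hf

theorem integrable_timeMeasure_iff {X : Type*} [NormedAddCommGroup X] {f : ℝ → X} (hT : 0 ≤ T) :
    Integrable f (timeMeasure T) ↔ IntervalIntegrable f volume 0 T := by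
  rw [intervalIntegrable_iff_integrableOn_Ioo_of_le hT]
  rfl

theorem integral_timeMeasure_eq (f : ℝ → X) (hT : 0 ≤ T) :
    ∫ t, f t ∂timeMeasure T = ∫ t in (0)..T, f t := by
  rw [intervalIntegral.integral_of_le hT, integral_Ioc_eq_integral_Ioo]

theorem integrable_smul_of_test {f : ℝ → X} (hf : Integrable f (timeMeasure T)) {φ : ℝ → ℝ}
    (hφ : Continuous φ) (hc : HasCompactSupport φ) :
    Integrable (fun t => φ t • f t) (timeMeasure T) := by
  obtain ⟨C, hC⟩ := hφ.bounded_above_of_compact_support hc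
  exact hf.bdd_smul C hφ.aestronglyMeasurable (ae_of_all _ hC)

theorem ae_eq_zero_of_integral_test_eq_zero [CompleteSpace X] {f : ℝ → X}
    (hf : Integrable f (timeMeasure T))
    (h : ∀ φ : ℝ → ℝ, ContDiff ℝ ∞ φ → HasCompactSupport φ → tsupport φ ⊆ Ioo 0 T →
      ∫ t, φ t • f t ∂timeMeasure T = 0) : ∀ᵐ t ∂timeMeasure T, f t = 0 := by
  rw [ae_restrict_iff' measurableSet_Ioo]
  refine isOpen_Ioo.ae_eq_zero_of_integral_contDiff_smul_eq_zero
    (IntegrableOn.locallyIntegrableOn hf) fun φ h1 h2 h3 => ?_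
  rw [← h φ h1 h2 h3, setIntegral_eq_integral_of_forall_compl_eq_zero]
  intro t ht
  rw [image_eq_zero_of_notMem_tsupport fun hh => ht (h3 hh), zero_smul]

theorem HasWeakTimeDeriv.unique [CompleteSpace X] {f g g' : ℝ → X}
    (hg : Integrable g (timeMeasure T))
    (hg' : Integrable g' (timeMeasure T)) (h : HasWeakTimeDeriv T f g)
    (h' : HasWeakTimeDeriv T f g') : g =ᵐ[timeMeasure T] g' := by
  have := ae_eq_zero_of_integral_test_eq_zero (hg.sub hg') fun φ h1 h2 h3 => by
    have e : ∫ t, φ t • g t ∂timeMeasure T = ∫ t, φ t • g' t ∂timeMeasure T := by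
      rw [← neg_inj, ← h φ h1 h2 h3, ← h' φ h1 h2 h3]
    simp only [Pi.sub_apply, smul_sub]
    rw [integral_sub (integrable_smul_of_test hg h1.continuous h2)
      (integrable_smul_of_test hg' h1.continuous h2), e, sub_self]
  filter_upwards [this] with t ht
  exact sub_eq_zero.1 ht

theorem HasWeakTimeDeriv.congr {f f₁ g : ℝ → X} (h : HasWeakTimeDeriv T f g)
    (hf : f =ᵐ[timeMeasure T] f₁) : HasWeakTimeDeriv T f₁ g := by
  intro φ h1 h2 h3
  rw [← h φ h1 h2 h3]
  refine integral_congr_ae ?_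
  filter_upwards [hf] with t ht
  rw [ht]

theorem HasWeakTimeDeriv.sub {f f₁ g g₁ : ℝ → X} (h : HasWeakTimeDeriv T f g)
    (h' : HasWeakTimeDeriv T f₁ g₁) (hf : Integrable f (timeMeasure T))
    (hf₁ : Integrable f₁ (timeMeasure T)) (hg : Integrable g (timeMeasure T))
    (hg₁ : Integrable g₁ (timeMeasure T)) :
    HasWeakTimeDeriv T (fun t => f t - f₁ t) (fun t => g t - g₁ t) := by
  intro φ h1 h2 h3
  have hc := h1.continuous_deriv (by simp)
  simp only [smul_sub]
  rw [integral_sub (integrable_smul_of_test hf hc h2.deriv)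
      (integrable_smul_of_test hf₁ hc h2.deriv),
    integral_sub (integrable_smul_of_test hg h1.continuous h2)
      (integrable_smul_of_test hg₁ h1.continuous h2), h φ h1 h2 h3, h' φ h1 h2 h3]
  abel

theorem HasWeakTimeDeriv.clm_comp [CompleteSpace X] [CompleteSpace Y] (L : X →L[ℝ] Y)
    {f g : ℝ → X} (h : HasWeakTimeDeriv T f g)
    (hf : Integrable f (timeMeasure T)) (hg : Integrable g (timeMeasure T)) :
    HasWeakTimeDeriv T (fun t => L (f t)) (fun t => L (g t)) := by
  intro φ h1 h2 h3
  have hc := h1.continuous_deriv (by simp)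
  have := congrArg L (h φ h1 h2 h3)
  rw [map_neg, ← L.integral_comp_comm (integrable_smul_of_test hf hc h2.deriv),
    ← L.integral_comp_comm (integrable_smul_of_test hg h1.continuous h2)] at this
  simpa using this

/-- Integration by parts; the boundary terms drop out because test functions vanish at 0 and T. -/
theorem hasWeakTimeDeriv_primitive [CompleteSpace X] (hT : 0 ≤ T) {g : ℝ → X}
    (hg : Integrable g (timeMeasure T)) :
    HasWeakTimeDeriv T (fun t => ∫ s in (0)..t, g s) g := by
  intro φ h1 h2 h3
  rw [integrable_timeMeasure_iff hT] at hg
  have hz : ∀ t ∉ Ioo 0 T, φ t = 0 := fun t ht =>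
    image_eq_zero_of_notMem_tsupport fun hh => ht (h3 hh)
  obtain ⟨-, -, h⟩ := integral_bilin_primitive (ContinuousLinearMap.lsmul ℝ ℝ (E := X))
    (h1.of_le (by simp)).contDiffOn.absolutelyContinuousOnInterval
    hg.absolutelyContinuousOnInterval_primitive
    (h1.continuous_deriv (by simp)).continuousOn.intervalIntegrable hg
    (ae_of_all _ fun x _ => (h1.differentiable (by simp) x).hasDerivAt)
    (by filter_upwards [hg.ae_hasDerivAt_integral] with x h hx using h hx 0 left_mem_uIcc)
  simp only [ContinuousLinearMap.lsmul_apply, hz 0 (by simp), hz T (by simp), zero_smul,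
    sub_zero] at h
  rw [integral_timeMeasure_eq _ hT, integral_timeMeasure_eq _ hT]
  exact eq_neg_of_add_eq_zero_left h

/-- A smooth function with compact support in `(0, T)` and zero integral is the derivative of a
function of the same kind. -/
theorem exists_test_deriv_eq (hT : 0 < T) {θ : ℝ → ℝ} (h1 : ContDiff ℝ ∞ θ)
    (h2 : HasCompactSupport θ) (h3 : tsupport θ ⊆ Ioo 0 T) (h4 : ∫ t in (0)..T, θ t = 0) :
    ∃ φ : ℝ → ℝ, ContDiff ℝ ∞ φ ∧ HasCompactSupport φ ∧ tsupport φ ⊆ Ioo 0 T ∧ deriv φ = θ := by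
  have hd : ∀ x, HasDerivAt (fun t => ∫ s in (0)..t, θ s) (θ x) x := fun x =>
    intervalIntegral.integral_hasDerivAt_right (h1.continuous.intervalIntegrable _ _)
      h1.continuous.aestronglyMeasurable.stronglyMeasurableAtFilter h1.continuous.continuousAt
  have hd' : deriv (fun t => ∫ s in (0)..t, θ s) = θ := funext fun x => (hd x).deriv
  -- The point T/2 keeps the compact set nonempty when θ = 0, so that its extrema exist.
  have hK : IsCompact (insert (T / 2) (tsupport θ)) := IsCompact.insert h2 _
  have hKs : insert (T / 2) (tsupport θ) ⊆ Ioo 0 T :=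
    insert_subset ⟨by linarith, by linarith⟩ h3
  obtain ⟨a, ha, hamin⟩ := hK.exists_isLeast (insert_nonempty _ _)
  obtain ⟨b, hb, hbmax⟩ := hK.exists_isGreatest (insert_nonempty _ _)
  have ha0 := hKs ha
  have hb0 := hKs hb
  have hzero : ∀ t ∉ Icc a b, θ t = 0 := fun t ht =>
    image_eq_zero_of_notMem_tsupport fun hh =>
      ht ⟨hamin (mem_insert_of_mem _ hh), hbmax (mem_insert_of_mem _ hh)⟩
  have hsupp : Function.support (fun t => ∫ s in (0)..t, θ s) ⊆ Icc a b := by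
    intro t ht
    by_contra hcon
    refine ht ?_
    rw [mem_Icc, not_and_or, not_le, not_le] at hcon
    rcases hcon with hta | htb
    · refine intervalIntegral.integral_zero_ae (ae_of_all _ fun s hs => hzero s fun hs' => ?_)
      rcases mem_uIoc.1 hs with h | h <;> linarith [hs'.1, ha0.1, h.2]
    -- To the right of `b` the primitive already equals the integral over (0, T), which is zero by
    -- hypothesis.
    · have : ∫ s in t..T, θ s = 0 := by
        refine intervalIntegral.integral_zero_ae (ae_of_all _ fun s hs => hzero s fun hs' => ?_)
        rcases mem_uIoc.1 hs with h | h <;> linarith [hs'.2, hb0.2, h.1]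
      have hadd := intervalIntegral.integral_add_adjacent_intervals
        (h1.continuous.intervalIntegrable 0 t) (h1.continuous.intervalIntegrable t T) (μ := volume)
      rw [this, h4, add_zero] at hadd
      exact hadd
  have hts : tsupport (fun t => ∫ s in (0)..t, θ s) ⊆ Icc a b :=
    closure_minimal hsupp isClosed_Icc
  refine ⟨fun t => ∫ s in (0)..t, θ s, ?_, ?_, ?_, hd'⟩
  · rw [contDiff_infty_iff_deriv, hd']
    exact ⟨fun x => (hd x).differentiableAt, h1⟩
  · exact isCompact_Icc.of_isClosed_subset (isClosed_tsupport _) hts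
  · exact hts.trans fun t ht => ⟨ha0.1.trans_le ht.1, ht.2.trans_lt hb0.2⟩

theorem exists_test_integral_eq_one (hT : 0 < T) :
    ∃ ρ : ℝ → ℝ, ContDiff ℝ ∞ ρ ∧ HasCompactSupport ρ ∧ tsupport ρ ⊆ Ioo 0 T ∧
      ∫ t in (0)..T, ρ t = 1 := by
  let B : ContDiffBump (T / 2) := ⟨T / 8, T / 4, by positivity, by linarith⟩
  have hsub : tsupport (B.normed volume) ⊆ Ioo 0 T := by
    rw [B.tsupport_normed_eq, Real.closedBall_eq_Icc]
    intro t ht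
    have h1 := ht.1
    have h2 := ht.2
    simp only [B] at h1 h2
    constructor <;> linarith
  refine ⟨B.normed volume, B.contDiff_normed, B.hasCompactSupport_normed, hsub, ?_⟩
  rw [← integral_timeMeasure_eq _ hT.le, setIntegral_eq_integral_of_forall_compl_eq_zero]
  · exact B.integral_normed
  · exact fun t ht => image_eq_zero_of_notMem_tsupport fun hh => ht (hsub hh)

/-- A function with zero weak derivative is almost everywhere constant. -/
theorem HasWeakTimeDeriv.exists_const [CompleteSpace X] (hT : 0 < T) {f : ℝ → X}
    (hf : Integrable f (timeMeasure T)) (h : HasWeakTimeDeriv T f 0) :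
    ∃ c, ∀ᵐ t ∂timeMeasure T, f t = c := by
  obtain ⟨ρ, r1, r2, r3, r4⟩ := exists_test_integral_eq_one hT
  refine ⟨∫ t, ρ t • f t ∂timeMeasure T, ?_⟩
  set c := ∫ t, ρ t • f t ∂timeMeasure T
  have hfc : Integrable (fun t => f t - c) (timeMeasure T) := hf.sub (integrable_const c)
  have := ae_eq_zero_of_integral_test_eq_zero hfc fun ψ p1 p2 p3 => by
    set I := ∫ t in (0)..T, ψ t with hI
    have hsup : tsupport (fun t => ψ t - I * ρ t) ⊆ tsupport ψ ∪ tsupport ρ :=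
      (tsupport_sub ψ (fun t => I * ρ t)).trans
        (union_subset_union_right _ (tsupport_mul_subset_right (f := fun _ => I)))
    -- Subtracting Iρ removes the mean of ψ, so the difference is the derivative of a test function
    -- and is annihilated by f. Hence ∫ψf = I·c.
    obtain ⟨φ, f1, f2, f3, f4⟩ := exists_test_deriv_eq hT (θ := fun t => ψ t - I * ρ t)
      (p1.sub (contDiff_const.mul r1)) (p2.sub r2.mul_left)
      (hsup.trans (union_subset p3 r3)) (by
        rw [intervalIntegral.integral_sub (p1.continuous.intervalIntegrable _ _)
          ((r1.continuous.intervalIntegrable _ _).const_mul I),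
          intervalIntegral.integral_const_mul, r4, mul_one, ← hI, sub_self])
    have hz := h φ f1 f2 f3
    rw [f4] at hz
    simp only [Pi.zero_apply, smul_zero, integral_zero, neg_zero, sub_smul, mul_smul] at hz
    rw [integral_sub (integrable_smul_of_test hf p1.continuous p2)
      ((integrable_smul_of_test hf r1.continuous r2).fun_smul I), integral_smul] at hz
    simp only [smul_sub]
    rw [integral_sub (integrable_smul_of_test hf p1.continuous p2)
      (integrable_smul_of_test (integrable_const c) p1.continuous p2), integral_smul_const,
      integral_timeMeasure_eq ψ hT.le]
    exact hz
  filter_upwards [this] with t ht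
  exact sub_eq_zero.1 ht

/-- A function with an integrable weak derivative is almost everywhere a primitive of it. -/
theorem HasWeakTimeDeriv.exists_ae_eq_primitive [CompleteSpace X] (hT : 0 < T) {f g : ℝ → X}
    (hf : Integrable f (timeMeasure T)) (hg : Integrable g (timeMeasure T))
    (h : HasWeakTimeDeriv T f g) :
    ∃ c, ∀ᵐ t ∂timeMeasure T, f t = c + ∫ s in (0)..t, g s := by
  have hG : Integrable (fun t => ∫ s in (0)..t, g s) (timeMeasure T) := by
    rw [integrable_timeMeasure_iff hT.le] at hg ⊢
    exact hg.absolutelyContinuousOnInterval_primitive.continuousOn.intervalIntegrable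
  have h0 := h.sub (hasWeakTimeDeriv_primitive hT.le hg) hf hG hg hg
  simp only [sub_self] at h0
  obtain ⟨c, hc⟩ := HasWeakTimeDeriv.exists_const hT (hf.sub hG) h0
  refine ⟨c, ?_⟩
  filter_upwards [hc] with t ht
  exact sub_eq_iff_eq_add.1 ht

/-- The energy identity for a symmetric bounded bilinear form. -/
theorem integral_symm_bilin_primitive [CompleteSpace X] (M : X →L[ℝ] X →L[ℝ] ℝ)
    (hM : ∀ x y, M x y = M y x) {g : ℝ → X} {t : ℝ} (hg : IntervalIntegrable g volume 0 t) (c : X) :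
    2 * ∫ s in (0)..t, M (g s) (c + ∫ r in (0)..s, g r)
      = M (c + ∫ r in (0)..t, g r) (c + ∫ r in (0)..t, g r) - M c c := by
  have hac := hg.absolutelyContinuousOnInterval_primitive.const_add c
  have hd := ae_hasDerivAt_const_add_integral c hg
  obtain ⟨-, -, h⟩ := integral_bilin_primitive M hac hac hg hg hd hd
  simp only [intervalIntegral.integral_same, add_zero] at h
  rw [← h, two_mul]
  congr 2
  funext s
  exact hM _ _

end WeakTimeDeriv

/-! ### The space `H¹₀(Ω)` -/

section TestFunctions

/-- The coordinate directions of `ℝ³`. -/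
noncomputable abbrev dir (i : Fin 3) : E3 := EuclideanSpace.single i 1

theorem integrable_mul_of_hasCompactSupport {f g : E3 → ℝ} (hf : Continuous f) (hg : Continuous g)
    (hc : HasCompactSupport g) : Integrable (fun x => f x * g x) :=
  (hf.mul hg).integrable_of_hasCompactSupport hc.mul_left

/-- Moving the derivative off ψ turns both sides into integrals of second derivatives of φ against
ψ, and these are symmetric. -/
theorem integral_partial_mul_partial_comm {φ ψ : E3 → ℝ} (hφ : ContDiff ℝ ∞ φ)
    (hψ : ContDiff ℝ ∞ ψ) (hψc : HasCompactSupport ψ) (v w : E3) :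
    ∫ x, fderiv ℝ φ x v * fderiv ℝ ψ x w = ∫ x, fderiv ℝ φ x w * fderiv ℝ ψ x v := by
  have hd : ∀ v, ContDiff ℝ ∞ (fun x => fderiv ℝ φ x v) := fun v =>
    (hφ.fderiv_right (m := ∞) (by simp)).clm_apply contDiff_const
  have hψd : ∀ v, Continuous (fun x => fderiv ℝ ψ x v) := fun v =>
    (hψ.continuous_fderiv (by simp)).clm_apply continuous_const
  have hψdc : ∀ v, HasCompactSupport (fun x => fderiv ℝ ψ x v) := fun v => hψc.fderiv_apply ℝ v
  have parts : ∀ v w, ∫ x, fderiv ℝ φ x v * fderiv ℝ ψ x w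
      = -∫ x, fderiv ℝ (fun y => fderiv ℝ φ y v) x w * ψ x := fun v w =>
    integral_mul_fderiv_eq_neg_fderiv_mul_of_integrable
      (integrable_mul_of_hasCompactSupport
        (((hd v).continuous_fderiv (by simp)).clm_apply continuous_const) hψ.continuous hψc)
      (integrable_mul_of_hasCompactSupport (hd v).continuous (hψd w) (hψdc w))
      (integrable_mul_of_hasCompactSupport (hd v).continuous hψ.continuous hψc)
      (fun x _ => (hd v).differentiable (by simp) x) (fun x _ => hψ.differentiable (by simp) x)
  rw [parts v w, parts w v]
  congr 2
  funext x
  have hdd : DifferentiableAt ℝ (fderiv ℝ φ) x :=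
    (hφ.fderiv_right (m := ∞) (by simp)).differentiable (by simp) x
  have second : ∀ v w, fderiv ℝ (fun y => fderiv ℝ φ y v) x w
      = fderiv ℝ (fderiv ℝ φ) x w v := fun v w => by
    rw [fderiv_clm_apply hdd (differentiableAt_const v)]
    simp
  rw [second, second, (hφ.contDiffAt.isSymmSndFDerivAt
    (by simpa using ENat.LEInfty.out)) v w]

/-- The Poincaré inequality for test functions supported in a slab. -/
theorem integral_sq_le_integral_partial_sq {φ : E3 → ℝ} (hφ : ContDiff ℝ ∞ φ)
    (hc : HasCompactSupport φ) {R : ℝ} (hR : ∀ x ∈ tsupport φ, |x 0| ≤ R) :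
    ∫ x, φ x * φ x ≤ 4 * R ^ 2 * ∫ x, fderiv ℝ φ x (dir 0) * fderiv ℝ φ x (dir 0) := by
  have hcont : Continuous (fun x => fderiv ℝ φ x (dir 0)) :=
    (hφ.continuous_fderiv (by simp)).clm_apply continuous_const
  have hdc : HasCompactSupport (fun x => fderiv ℝ φ x (dir 0)) := hc.fderiv_apply ℝ _
  -- Since ∂₀x₀ = 1, integrating φ²∂₀x₀ by parts gives ∫φ² = −2∫x₀φ∂₀φ.
  let π : E3 →L[ℝ] ℝ := EuclideanSpace.proj 0
  have hπ : ∀ x, fderiv ℝ π x (dir 0) = 1 := fun x => by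
    rw [π.fderiv]
    simp [π, dir]
  have hsq : ContDiff ℝ ∞ (fun x => φ x * φ x) := hφ.mul hφ
  have hsqd : ∀ x, fderiv ℝ (fun x => φ x * φ x) x (dir 0) = 2 * φ x * fderiv ℝ φ x (dir 0) := by
    intro x
    have hx := hφ.differentiable (by simp) x
    rw [fderiv_fun_mul hx hx]
    simp
    ring
  have iφ : Integrable (fun x => φ x * φ x) :=
    integrable_mul_of_hasCompactSupport hφ.continuous hφ.continuous hc
  have idφ : Integrable (fun x => fderiv ℝ φ x (dir 0) * fderiv ℝ φ x (dir 0)) :=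
    integrable_mul_of_hasCompactSupport hcont hcont hdc
  have iright : Integrable (fun x => 2 * φ x * fderiv ℝ φ x (dir 0) * π x) := by
    have := integrable_mul_of_hasCompactSupport ((hφ.continuous.const_mul 2).mul π.continuous) hcont hdc
    refine this.congr (ae_of_all _ fun x => ?_)
    simp only [Pi.mul_apply]
    ring
  have parts := integral_mul_fderiv_eq_neg_fderiv_mul_of_integrable (μ := volume) (v := dir 0)
    (f := fun x => φ x * φ x) (g := π)
    (by simpa only [hsqd] using iright)
    (by simpa only [hπ, mul_one] using iφ)
    ((hsq.continuous.mul π.continuous).integrable_of_hasCompactSupport (hc.mul_left.mul_right))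
    (fun x _ => hsq.differentiable (by simp) x) (fun x _ => π.differentiableAt)
  simp only [hsqd, hπ, mul_one] at parts
  -- Young's inequality is weighted so that half of ∫φ² can be absorbed on the left; this yields the
  -- constant 4R².
  have hbound : -∫ x, 2 * φ x * fderiv ℝ φ x (dir 0) * π x
      ≤ ∫ x, (1 / 2 * (φ x * φ x)
        + 2 * R ^ 2 * (fderiv ℝ φ x (dir 0) * fderiv ℝ φ x (dir 0))) := by
    rw [← integral_neg]
    refine integral_mono iright.neg ((iφ.const_mul _).add (idφ.const_mul _)) fun x => ?_
    beta_reduce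
    by_cases hx : x ∈ tsupport φ
    · have h1 : (π x) ^ 2 ≤ R ^ 2 := sq_le_sq' (abs_le.1 (hR x hx)).1 (abs_le.1 (hR x hx)).2
      have h2 := mul_le_mul_of_nonneg_right h1 (sq_nonneg (fderiv ℝ φ x (dir 0)))
      nlinarith [sq_nonneg (φ x + 2 * (π x * fderiv ℝ φ x (dir 0)))]
    · rw [image_eq_zero_of_notMem_tsupport hx]
      have := mul_self_nonneg (fderiv ℝ φ x (dir 0))
      have h3 := mul_nonneg (sq_nonneg R) this
      linarith
  rw [integral_add (iφ.const_mul _) (idφ.const_mul _), integral_const_mul, integral_const_mul,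
    ← parts] at hbound
  linarith

end TestFunctions

section Sobolev

variable {Ω : Set E3}

/-- `f` is represented by the test function `φ`. -/
def IsRepr (f : H10 Ω) (φ : E3 → ℝ) : Prop :=
  ContDiff ℝ ∞ φ ∧ HasCompactSupport φ ∧ tsupport φ ⊆ Ω ∧
    val Ω f =ᵐ[volume.restrict Ω] φ ∧
    ∀ i : Fin 3, pd Ω i f =ᵐ[volume.restrict Ω] fun x => fderiv ℝ φ x (dir i)

/-- Closed properties of `H¹₀(Ω)` hold if they hold for test functions. -/
theorem H10.induction_on {p : H10 Ω → Prop} (hp : IsClosed {f | p f})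
    (h : ∀ f φ, IsRepr f φ → p f) (f : H10 Ω) : p f := by
  have hd : DenseRange (inclusion (subset_closure
      (s := (testPairs Ω : Set (WithLp 2 (L2 Ω × L2Vec Ω)))))) :=
    (denseRange_inclusion_iff _).2 (Subset.refl _)
  refine hd.induction_on (p := p) f hp fun v => ?_
  obtain ⟨φ, h1, h2, h3, h4, h5⟩ := v.2
  exact h _ φ ⟨h1, h2, h3, h4, h5⟩

/-- Passing to the whole space allows integration by parts without boundary terms on ∂Ω. -/
theorem inner_eq_integral {f g : L2 Ω} {φ ψ : E3 → ℝ} (hf : f =ᵐ[volume.restrict Ω] φ)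
    (hg : g =ᵐ[volume.restrict Ω] ψ) (hψ : tsupport ψ ⊆ Ω) :
    inner ℝ f g = ∫ x, φ x * ψ x := by
  rw [L2.inner_def,
    ← setIntegral_eq_integral_of_forall_compl_eq_zero (s := Ω) (f := fun x => φ x * ψ x)]
  · refine integral_congr_ae ?_
    filter_upwards [hf, hg] with x h1 h2
    simp [h1, h2, mul_comm]
  · intro x hx
    rw [image_eq_zero_of_notMem_tsupport fun hh => hx (hψ hh), mul_zero]

theorem IsRepr.tsupport_partial_subset {f : H10 Ω} {φ : E3 → ℝ} (h : IsRepr f φ) (i : Fin 3) :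
    tsupport (fun x => fderiv ℝ φ x (dir i)) ⊆ Ω :=
  (tsupport_fderiv_apply_subset ℝ (dir i)).trans h.2.2.1

/-- Both sides are continuous in each argument, so density reduces the claim to test functions. -/
theorem inner_pd_pd_comm (f g : H10 Ω) (i j : Fin 3) :
    inner ℝ (pd Ω i f) (pd Ω j g) = inner ℝ (pd Ω j f) (pd Ω i g) := by
  refine H10.induction_on (p := fun f => inner ℝ (pd Ω i f) (pd Ω j g)
    = inner ℝ (pd Ω j f) (pd Ω i g)) (isClosed_eq (by fun_prop) (by fun_prop)) ?_ f
  intro f φ hf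
  refine H10.induction_on (p := fun g => inner ℝ (pd Ω i f) (pd Ω j g)
    = inner ℝ (pd Ω j f) (pd Ω i g)) (isClosed_eq (by fun_prop) (by fun_prop)) ?_ g
  intro g ψ hg
  rw [inner_eq_integral (hf.2.2.2.2 i) (hg.2.2.2.2 j) (hg.tsupport_partial_subset j),
    inner_eq_integral (hf.2.2.2.2 j) (hg.2.2.2.2 i) (hg.tsupport_partial_subset i)]
  exact integral_partial_mul_partial_comm hf.1 hg.1 hg.2.1 _ _

/-- The Poincaré inequality in `H¹₀(Ω)`, `Ω` bounded. -/
theorem exists_poincare (hΩ : Bornology.IsBounded Ω) :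
    ∃ C : ℝ, 0 ≤ C ∧ ∀ f : H10 Ω, ‖val Ω f‖ ^ 2 ≤ C * ‖pd Ω 0 f‖ ^ 2 := by
  obtain ⟨R, hR⟩ := hΩ.exists_norm_le
  refine ⟨4 * R ^ 2, by positivity, fun f => ?_⟩
  refine H10.induction_on (p := fun f => ‖val Ω f‖ ^ 2 ≤ 4 * R ^ 2 * ‖pd Ω 0 f‖ ^ 2)
    (isClosed_le (by fun_prop) (by fun_prop)) (fun f φ hf => ?_) f
  rw [← real_inner_self_eq_norm_sq, ← real_inner_self_eq_norm_sq,
    inner_eq_integral hf.2.2.2.1 hf.2.2.2.1 hf.2.2.1,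
    inner_eq_integral (hf.2.2.2.2 0) (hf.2.2.2.2 0) (hf.tsupport_partial_subset 0)]
  refine integral_sq_le_integral_partial_sq hf.1 hf.2.1 fun x hx => ?_
  exact (PiLp.norm_apply_le x 0).trans (hR x (hf.2.2.1 hx))

theorem H10.norm_sq_eq (f : H10 Ω) : ‖f‖ ^ 2 = ‖val Ω f‖ ^ 2 + ∑ i, ‖pd Ω i f‖ ^ 2 := by
  have h1 : ‖f‖ = ‖graph Ω f‖ := rfl
  rw [h1, WithLp.prod_norm_sq_eq_of_L2, PiLp.norm_sq_eq_of_L2]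
  rfl

theorem H10.exists_norm_sq_le (hΩ : Bornology.IsBounded Ω) :
    ∃ C : ℝ, 0 < C ∧ ∀ f : H10 Ω, ‖f‖ ^ 2 ≤ C * ∑ i, ‖pd Ω i f‖ ^ 2 := by
  obtain ⟨C, hC, h⟩ := exists_poincare hΩ
  refine ⟨C + 1, by positivity, fun f => ?_⟩
  have h0 : ‖pd Ω 0 f‖ ^ 2 ≤ ∑ i, ‖pd Ω i f‖ ^ 2 :=
    Finset.single_le_sum (f := fun i => ‖pd Ω i f‖ ^ 2) (fun _ _ => by positivity)
      (Finset.mem_univ _)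
  rw [H10.norm_sq_eq]
  have := mul_le_mul_of_nonneg_left h0 hC
  linarith [h f]

/-! ### The elasticity form -/

/-- The elasticity form as a bounded bilinear map. -/
noncomputable def elastL (Ω : Set E3) : H10Vec Ω →L[ℝ] H10Vec Ω →L[ℝ] ℝ :=
  (innerSL ℝ).bilinearComp (dvg Ω) (dvg Ω)
    + ∑ i : Fin 3, ∑ j : Fin 3, (innerSL ℝ).bilinearComp ((pd Ω j).comp (comp Ω i))
        ((pd Ω j).comp (comp Ω i))
    + ∑ i : Fin 3, ∑ j : Fin 3, (innerSL ℝ).bilinearComp ((pd Ω j).comp (comp Ω i))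
        ((pd Ω i).comp (comp Ω j))

theorem elastL_apply (u w : H10Vec Ω) : elastL Ω u w = elast u w := by
  simp [elastL, elast, comp]

theorem dvg_apply (u : H10Vec Ω) : dvg Ω u = ∑ i, pd Ω i (u i) := by
  simp [dvg, comp]

theorem elast_comm (u w : H10Vec Ω) : elast u w = elast w u := by
  unfold elast
  congr 1
  · congr 1
    · exact real_inner_comm _ _
    · exact Finset.sum_congr rfl fun i _ => Finset.sum_congr rfl fun j _ => real_inner_comm _ _
  · rw [Finset.sum_comm]
    exact Finset.sum_congr rfl fun i _ => Finset.sum_congr rfl fun j _ => real_inner_comm _ _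

/-- Exchanging derivatives turns (∇u, ∇uᵀ) into ‖∇·u‖². The full gradient survives with coefficient
1, so coercivity needs Poincaré's inequality but no separate Korn inequality. -/
theorem elast_self (u : H10Vec Ω) :
    elast u u = 2 * ‖dvg Ω u‖ ^ 2 + ∑ i : Fin 3, ∑ j : Fin 3, ‖pd Ω j (u i)‖ ^ 2 := by
  have h : ∑ i : Fin 3, ∑ j : Fin 3, inner ℝ (pd Ω j (u i)) (pd Ω i (u j)) = ‖dvg Ω u‖ ^ 2 := by
    rw [← real_inner_self_eq_norm_sq, dvg_apply, sum_inner]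
    refine Finset.sum_congr rfl fun i _ => ?_
    rw [inner_sum]
    exact Finset.sum_congr rfl fun j _ => inner_pd_pd_comm _ _ _ _
  unfold elast
  rw [h, real_inner_self_eq_norm_sq]
  simp only [real_inner_self_eq_norm_sq]
  ring

theorem elastL_isCoercive (hΩ : Bornology.IsBounded Ω) : IsCoercive (elastL Ω) := by
  obtain ⟨C, hC, h⟩ := H10.exists_norm_sq_le hΩ
  refine ⟨C⁻¹, by positivity, fun u => ?_⟩
  rw [elastL_apply, elast_self, mul_assoc, inv_mul_le_iff₀ hC, ← sq, PiLp.norm_sq_eq_of_L2]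
  have : ∑ i, ‖u i‖ ^ 2 ≤ ∑ i : Fin 3, C * ∑ j : Fin 3, ‖pd Ω j (u i)‖ ^ 2 :=
    Finset.sum_le_sum fun i _ => h (u i)
  rw [← Finset.mul_sum] at this
  refine this.trans (mul_le_mul_of_nonneg_left ?_ hC.le)
  have := sq_nonneg ‖dvg Ω u‖
  linarith

/-- The operator `L²(Ω) → 𝐕` that solves the elasticity problem with a given pressure. -/
noncomputable def solveElast (hΩ : Bornology.IsBounded Ω) : L2 Ω →L[ℝ] H10Vec Ω :=
  ((elastL_isCoercive hΩ).continuousLinearEquivOfBilin.symm :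
    H10Vec Ω →L[ℝ] H10Vec Ω).comp (ContinuousLinearMap.adjoint (dvg Ω))

theorem elast_solveElast (hΩ : Bornology.IsBounded Ω) (f : L2 Ω) (w : H10Vec Ω) :
    elast (solveElast hΩ f) w = inner ℝ f (dvg Ω w) := by
  rw [← elastL_apply, ← (elastL_isCoercive hΩ).continuousLinearEquivOfBilin_apply]
  simp [solveElast, ContinuousLinearMap.adjoint_inner_left]

/-- The operator `f ↦ c₀ f + ∇·u`, where `u` is the displacement caused by the pressure `f`. -/
noncomputable def storage (hΩ : Bornology.IsBounded Ω) (c₀ : ℝ) : L2 Ω →L[ℝ] L2 Ω :=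
  c₀ • ContinuousLinearMap.id ℝ (L2 Ω) + (dvg Ω).comp (solveElast hΩ)

theorem storage_apply (hΩ : Bornology.IsBounded Ω) (c₀ : ℝ) (f : L2 Ω) :
    storage hΩ c₀ f = c₀ • f + dvg Ω (solveElast hΩ f) := rfl

/-- The divergence terms are values of the symmetric elasticity form at the two displacements. -/
theorem inner_storage_comm (hΩ : Bornology.IsBounded Ω) (c₀ : ℝ) (f g : L2 Ω) :
    inner ℝ (storage hΩ c₀ f) g = inner ℝ (storage hΩ c₀ g) f := by
  rw [storage_apply, storage_apply, inner_add_left, inner_add_left, real_inner_smul_left,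
    real_inner_smul_left, real_inner_comm g f, real_inner_comm g (dvg Ω _),
    real_inner_comm f (dvg Ω _), ← elast_solveElast hΩ g, ← elast_solveElast hΩ f, elast_comm]

/-- With d the divergence of the displacement caused by f, testing the elasticity problem with that
displacement gives ‖d‖² ≤ (f, d). The rest is (c₀‖f‖ + ‖d‖)² ≤ 2c₀²‖f‖² + 2‖d‖². This is what closes
the Grönwall argument when c₀ = 0. -/
theorem norm_storage_sq_le (hΩ : Bornology.IsBounded Ω) {c₀ : ℝ} (hc₀ : 0 ≤ c₀) (f : L2 Ω) :
    ‖storage hΩ c₀ f‖ ^ 2 ≤ 2 * (c₀ + 1) * inner ℝ (storage hΩ c₀ f) f := by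
  set d := dvg Ω (solveElast hΩ f)
  have h1 : ‖d‖ ^ 2 ≤ inner ℝ f d := by
    rw [← elast_solveElast hΩ, elast_self]
    have : 0 ≤ ∑ i : Fin 3, ∑ j : Fin 3, ‖pd Ω j ((solveElast hΩ f) i)‖ ^ 2 :=
      Finset.sum_nonneg fun i _ => Finset.sum_nonneg fun j _ => by positivity
    linarith [sq_nonneg ‖dvg Ω (solveElast hΩ f)‖]
  have h2 : inner ℝ (storage hΩ c₀ f) f = c₀ * ‖f‖ ^ 2 + inner ℝ f d := by
    rw [storage_apply, inner_add_left, real_inner_smul_left, real_inner_self_eq_norm_sq,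
      real_inner_comm]
  have h3 : ‖storage hΩ c₀ f‖ ≤ c₀ * ‖f‖ + ‖d‖ := by
    rw [storage_apply]
    refine (norm_add_le _ _).trans ?_
    rw [norm_smul, Real.norm_of_nonneg hc₀]
  have h4 : ‖storage hΩ c₀ f‖ ^ 2 ≤ (c₀ * ‖f‖ + ‖d‖) ^ 2 := by gcongr
  rw [h2]
  have h5 := mul_nonneg hc₀ (sq_nonneg ‖f‖)
  have h6 := mul_nonneg hc₀ ((sq_nonneg ‖d‖).trans h1)
  nlinarith [sq_nonneg (c₀ * ‖f‖ - ‖d‖)]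

end Sobolev

/-! ### The diffusion form -/

section Diffusion

variable {Ω : Set E3} {k : ℝ → ℝ}

theorem integrable_mul_L2 (a b : L2 Ω) : Integrable (fun x => a x * b x) (volume.restrict Ω) :=
  (Lp.memLp a).integrable_mul (Lp.memLp b)

theorem L2.norm_sq_eq_integral (a : L2 Ω) : ‖a‖ ^ 2 = ∫ x in Ω, a x * a x := by
  rw [← real_inner_self_eq_norm_sq, L2.inner_def]
  rfl

theorem aestronglyMeasurable_comp_L2 (hk : Continuous k) (z : L2 Ω) :
    AEStronglyMeasurable (fun x => k (z x)) (volume.restrict Ω) :=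
  hk.comp_aestronglyMeasurable (Lp.aestronglyMeasurable z)

theorem integrable_weight_mul (hk : Continuous k) {C : ℝ} (hC : ∀ x, |k x| ≤ C) (z a b : L2 Ω) :
    Integrable (fun x => k (z x) * (a x * b x)) (volume.restrict Ω) :=
  (integrable_mul_L2 a b).bdd_mul (aestronglyMeasurable_comp_L2 hk z) (ae_of_all _ fun _ => hC _)

/-- The form `(k(z) a, b)` on `L²(Ω)`. -/
noncomputable def weightForm (k : ℝ → ℝ) (z a b : L2 Ω) : ℝ :=
  ∫ x in Ω, k (z x) * (a x * b x)

theorem diffusion_eq_sum_weightForm (hk : Continuous k) {C : ℝ} (hC : ∀ x, |k x| ≤ C) (z : L2 Ω)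
    (p q : H10 Ω) : diffusion k z p q = ∑ i, weightForm k z (pd Ω i p) (pd Ω i q) := by
  unfold diffusion weightForm
  rw [← integral_finsetSum _ fun i _ => integrable_weight_mul hk hC z _ _]
  simp only [Finset.mul_sum]

theorem integral_abs_mul_le (a b : L2 Ω) : ∫ x in Ω, |a x * b x| ≤ ‖a‖ * ‖b‖ := by
  have h : ∫ x in Ω, |a x * b x| = inner ℝ |a| |b| := by
    rw [L2.inner_def]
    refine integral_congr_ae ?_
    filter_upwards [Lp.coeFn_abs a, Lp.coeFn_abs b] with x h1 h2
    rw [h1, h2, abs_mul]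
    simp [mul_comm]
  rw [h]
  simpa only [norm_abs_eq_norm] using real_inner_le_norm |a| |b|

theorem abs_weightForm_le {C : ℝ} (hC : ∀ x, |k x| ≤ C) (z a b : L2 Ω) :
    |weightForm k z a b| ≤ C * (‖a‖ * ‖b‖) := by
  have hC0 : 0 ≤ C := (abs_nonneg _).trans (hC 0)
  have h1 : |weightForm k z a b| ≤ ∫ x in Ω, C * |a x * b x| := by
    rw [← Real.norm_eq_abs]
    refine norm_integral_le_of_norm_le ((integrable_mul_L2 a b).abs.const_mul C)
      (ae_of_all _ fun x => ?_)
    rw [norm_mul, Real.norm_eq_abs, Real.norm_eq_abs]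
    exact mul_le_mul_of_nonneg_right (hC _) (abs_nonneg _)
  rw [integral_const_mul] at h1
  exact h1.trans (mul_le_mul_of_nonneg_left (integral_abs_mul_le a b) hC0)

/-- An L²-convergent sequence has an almost everywhere convergent subsequence, to which dominated
convergence applies; the subsequence principle does the rest. -/
theorem continuous_weightForm_left (hk : Continuous k) {C : ℝ} (hC : ∀ x, |k x| ≤ C) (a b : L2 Ω) :
    Continuous fun z => weightForm k z a b := by
  rw [continuous_iff_seqContinuous]
  intro z z₀ hz
  refine tendsto_of_subseq_tendsto fun n hn => ?_
  obtain ⟨m, -, hm⟩ := (tendstoInMeasure_of_tendsto_Lp (hz.comp hn)).exists_seq_tendsto_ae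
  refine ⟨m, ?_⟩
  refine tendsto_integral_of_dominated_convergence (fun x => C * |a x * b x|)
    (fun i => (integrable_weight_mul hk hC _ a b).1) ((integrable_mul_L2 a b).abs.const_mul C)
    (fun i => ae_of_all _ fun x => ?_) ?_
  · rw [norm_mul, Real.norm_eq_abs, Real.norm_eq_abs]
    exact mul_le_mul_of_nonneg_right (hC _) (abs_nonneg _)
  · filter_upwards [hm] with x hx
    exact ((hk.tendsto _).comp hx).mul_const _

theorem weightForm_sub (hk : Continuous k) {C : ℝ} (hC : ∀ x, |k x| ≤ C) (z a a' b b' : L2 Ω) :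
    weightForm k z a' b' - weightForm k z a b
      = weightForm k z (a' - a) b' + weightForm k z a (b' - b) := by
  unfold weightForm
  rw [← integral_sub (integrable_weight_mul hk hC _ _ _) (integrable_weight_mul hk hC _ _ _),
    ← integral_add (integrable_weight_mul hk hC _ _ _) (integrable_weight_mul hk hC _ _ _)]
  refine integral_congr_ae ?_
  filter_upwards [Lp.coeFn_sub a' a, Lp.coeFn_sub b' b] with x h1 h2
  rw [h1, h2, Pi.sub_apply, Pi.sub_apply]
  ring

theorem continuous_weightForm (hk : Continuous k) {C : ℝ} (hC : ∀ x, |k x| ≤ C) :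
    Continuous fun w : L2 Ω × L2 Ω × L2 Ω => weightForm k w.1 w.2.1 w.2.2 := by
  rw [continuous_iff_continuousAt]
  rintro ⟨z, a, b⟩
  rw [ContinuousAt, tendsto_iff_norm_sub_tendsto_zero]
  have hlim : Tendsto (fun w : L2 Ω × L2 Ω × L2 Ω =>
      C * (‖w.2.1 - a‖ * ‖w.2.2‖) + C * (‖a‖ * ‖w.2.2 - b‖)
        + |weightForm k w.1 a b - weightForm k z a b|) (𝓝 (z, a, b)) (𝓝 0) := by
    have hc : Continuous (fun w : L2 Ω × L2 Ω × L2 Ω =>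
      C * (‖w.2.1 - a‖ * ‖w.2.2‖) + C * (‖a‖ * ‖w.2.2 - b‖)
        + |weightForm k w.1 a b - weightForm k z a b|) := by
      have := (continuous_weightForm_left hk hC a b).comp
        (continuous_fst (X := L2 Ω) (Y := L2 Ω × L2 Ω))
      simp only [Function.comp_def] at this
      fun_prop
    simpa using hc.tendsto (z, a, b)
  refine squeeze_zero (fun _ => norm_nonneg _) (fun w => ?_) hlim
  have e : weightForm k w.1 w.2.1 w.2.2 - weightForm k z a b
      = weightForm k w.1 (w.2.1 - a) w.2.2 + weightForm k w.1 a (w.2.2 - b)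
        + (weightForm k w.1 a b - weightForm k z a b) := by
    rw [← weightForm_sub hk hC]
    ring
  rw [e, Real.norm_eq_abs]
  refine (abs_add_le _ _).trans (add_le_add_left ((abs_add_le _ _).trans (add_le_add ?_ ?_)) _)
  · exact abs_weightForm_le hC _ _ _
  · exact abs_weightForm_le hC _ _ _

/-- Supplies the measurability in time of the nonlinear diffusion term. -/
theorem continuous_diffusion (hk : Continuous k) {C : ℝ} (hC : ∀ x, |k x| ≤ C) :
    Continuous fun w : L2 Ω × H10 Ω × H10 Ω => diffusion k w.1 w.2.1 w.2.2 := by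
  simp only [diffusion_eq_sum_weightForm hk hC]
  refine continuous_finsetSum _ fun i _ => (continuous_weightForm hk hC).comp
    (continuous_fst.prodMk ((by fun_prop : Continuous fun w : L2 Ω × H10 Ω × H10 Ω =>
      pd Ω i w.2.1).prodMk (by fun_prop)))

theorem norm_pd_le (i : Fin 3) (f : H10 Ω) : ‖pd Ω i f‖ ≤ ‖f‖ := by
  refine abs_le_of_sq_le_sq' ?_ (norm_nonneg _) |>.2
  rw [H10.norm_sq_eq]
  have := Finset.single_le_sum (f := fun i => ‖pd Ω i f‖ ^ 2) (fun _ _ => by positivity)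
      (Finset.mem_univ i)
  linarith [sq_nonneg ‖val Ω f‖]

theorem abs_diffusion_le (hk : Continuous k) {C : ℝ} (hC : ∀ x, |k x| ≤ C) (z : L2 Ω)
    (p q : H10 Ω) : |diffusion k z p q| ≤ 3 * C * (‖p‖ * ‖q‖) := by
  have hC0 : 0 ≤ C := (abs_nonneg _).trans (hC 0)
  rw [diffusion_eq_sum_weightForm hk hC]
  refine (Finset.abs_sum_le_sum_abs _ _).trans ?_
  refine (Finset.sum_le_card_nsmul _ _ (C * (‖p‖ * ‖q‖)) fun i _ => ?_).trans_eq ?_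
  · refine (abs_weightForm_le hC _ _ _).trans ?_
    gcongr
    · exact norm_pd_le i p
    · exact norm_pd_le i q
  · simp
    ring

theorem integrable_diffusion {T : ℝ} (hk : Continuous k) {C : ℝ} (hC : ∀ x, |k x| ≤ C)
    {z : ℝ → L2 Ω} {p q : ℝ → H10 Ω} (hz : MemL2Time T z) (hp : MemL2Time T p)
    (hq : MemL2Time T q) :
    Integrable (fun t => diffusion k (z t) (p t) (q t)) (timeMeasure T) := by
  refine ((hp.norm.integrable_mul hq.norm).const_mul (3 * C)).mono'
    ((continuous_diffusion hk hC).comp_aestronglyMeasurable (hz.1.prodMk (hp.1.prodMk hq.1)))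
    (ae_of_all _ fun t => abs_diffusion_le hk hC _ _ _)

theorem ae_abs_pd_le_w1InfNorm {p : H10 Ω} (hp : w1InfNorm p < ⊤) (i : Fin 3) :
    ∀ᵐ x ∂volume.restrict Ω, |pd Ω i p x| ≤ (w1InfNorm p).toReal := by
  have h1 : eLpNorm (pd Ω i p) ⊤ (volume.restrict Ω) ≤ w1InfNorm p := by
    refine le_trans ?_ le_add_self
    exact Finset.single_le_sum (f := fun i => eLpNorm (pd Ω i p) ⊤ (volume.restrict Ω))
      (fun _ _ => bot_le) (Finset.mem_univ i)
  rw [eLpNorm_exponent_top] at h1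
  filter_upwards [ae_le_eLpNormEssSup (f := pd Ω i p) (μ := volume.restrict Ω)] with x hx
  have := ENNReal.toReal_mono hp.ne (hx.trans h1)
  simpa using this

/-- Monotonicity of the diffusion term up to a perturbation by the difference of the weights. -/
theorem le_diffusion_sub_diffusion (hk : Continuous k) {C κ : ℝ} (hC : ∀ x, |k x| ≤ C)
    (hκ : 0 < κ) (hκk : ∀ x, κ ≤ k x) {L : ℝ≥0} (hL : LipschitzWith L k) (z₁ z₂ : L2 Ω)
    {p : H10 Ω} (q : H10 Ω) (hp : w1InfNorm p < ⊤) :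
    κ / 2 * ∑ i, ‖pd Ω i (q - p)‖ ^ 2
        - 3 * (L ^ 2 / (2 * κ)) * (w1InfNorm p).toReal ^ 2 * ‖z₁ - z₂‖ ^ 2
      ≤ diffusion k z₁ q (q - p) - diffusion k z₂ p (q - p) := by
  set N := (w1InfNorm p).toReal
  have hN : 0 ≤ N := ENNReal.toReal_nonneg
  -- The estimate is made for each coordinate; summing produces the factor 3.
  have key : ∀ i, κ / 2 * ‖pd Ω i (q - p)‖ ^ 2 - L ^ 2 / (2 * κ) * N ^ 2 * ‖z₁ - z₂‖ ^ 2
      ≤ weightForm k z₁ (pd Ω i q) (pd Ω i (q - p)) - weightForm k z₂ (pd Ω i p) (pd Ω i (q - p)) := by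
    intro i
    unfold weightForm
    rw [L2.norm_sq_eq_integral, L2.norm_sq_eq_integral,
      ← integral_sub (integrable_weight_mul hk hC _ _ _) (integrable_weight_mul hk hC _ _ _),
      ← integral_const_mul, ← integral_const_mul,
      ← integral_sub ((integrable_mul_L2 _ _).const_mul _) ((integrable_mul_L2 _ _).const_mul _)]
    refine integral_mono_ae (((integrable_mul_L2 _ _).const_mul _).sub
      ((integrable_mul_L2 _ _).const_mul _))
      ((integrable_weight_mul hk hC _ _ _).sub (integrable_weight_mul hk hC _ _ _)) ?_
    have hsub : pd Ω i (q - p) = pd Ω i q - pd Ω i p := map_sub _ _ _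
    rw [hsub]
    filter_upwards [ae_abs_pd_le_w1InfNorm hp i, Lp.coeFn_sub z₁ z₂,
      Lp.coeFn_sub (pd Ω i q) (pd Ω i p)] with x h1 h2 h3
    simp only [h2, h3, Pi.sub_apply]
    have hlip : |k (z₁ x) - k (z₂ x)| ≤ L * |z₁ x - z₂ x| := by
      simpa [Real.dist_eq] using hL.dist_le_mul (z₁ x) (z₂ x)
    set d := pd Ω i q x - pd Ω i p x
    set y := z₁ x - z₂ x
    set s := (k (z₁ x) - k (z₂ x)) * pd Ω i p x with hs
    have hsb : |s| ≤ L * N * |y| := by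
      rw [hs, abs_mul]
      calc _ ≤ (L * |y|) * N := mul_le_mul hlip h1 (abs_nonneg _) (by positivity)
        _ = _ := by ring
    have hs2 : s ^ 2 ≤ (L * N * |y|) ^ 2 := by
      rw [← sq_abs s]
      gcongr
    -- This splitting puts the difference of the weights on the derivative of `p`, the one that is
    -- bounded.
    have e : k (z₁ x) * (pd Ω i q x * d) - k (z₂ x) * (pd Ω i p x * d)
        = k (z₁ x) * (d * d) + s * d := by
      simp only [hs, d]
      ring
    rw [e]
    have h4 := mul_le_mul_of_nonneg_right (hκk (z₁ x)) (mul_self_nonneg d)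
    have h5 : 0 ≤ κ / 2 * (d * d) + s * d + s ^ 2 / (2 * κ) := by
      have : κ / 2 * (d * d) + s * d + s ^ 2 / (2 * κ) = (κ * d + s) ^ 2 / (2 * κ) := by
        field_simp
        ring
      rw [this]
      positivity
    have h6 : s ^ 2 / (2 * κ) ≤ L ^ 2 / (2 * κ) * N ^ 2 * (y * y) := by
      have : (L : ℝ) ^ 2 / (2 * κ) * N ^ 2 * (y * y) = (L * N * |y|) ^ 2 / (2 * κ) := by
        rw [mul_pow, sq_abs]
        ring
      rw [this]
      gcongr
    linarith
  rw [diffusion_eq_sum_weightForm hk hC, diffusion_eq_sum_weightForm hk hC,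
    ← Finset.sum_sub_distrib]
  refine le_trans (le_of_eq ?_) (Finset.sum_le_sum fun i _ => key i)
  rw [Finset.sum_sub_distrib, ← Finset.mul_sum]
  simp
  ring

end Diffusion

/-! ### Uniqueness -/

section Uniqueness

variable {Ω : Set E3} {T c₀ : ℝ} {k : ℝ → ℝ} {F : ℝ → L2Vec Ω} {S : ℝ → StrongDual ℝ (H10 Ω)}
  {d₀ : L2 Ω} {u v : ℝ → H10Vec Ω} {p q : ℝ → H10 Ω}

theorem MemL2Time.clm_comp {X Y : Type*} [NormedAddCommGroup X] [NormedSpace ℝ X]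
    [NormedAddCommGroup Y] [NormedSpace ℝ Y] (L : X →L[ℝ] Y) {f : ℝ → X} (hf : MemL2Time T f) :
    MemL2Time T (fun t => L (f t)) :=
  L.comp_memLp' hf

theorem MemL2Time.integrable_bilin {X Y : Type*} [NormedAddCommGroup X] [NormedSpace ℝ X]
    [NormedAddCommGroup Y] [NormedSpace ℝ Y] (M : X →L[ℝ] Y →L[ℝ] ℝ) {f : ℝ → X} {g : ℝ → Y}
    (hf : MemL2Time T f) (hg : MemL2Time T g) :
    Integrable (fun t => M (f t) (g t)) (timeMeasure T) := by
  refine ((hf.norm.integrable_mul hg.norm).const_mul ‖M‖).mono'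
    (M.aestronglyMeasurable_comp₂ hf.1 hg.1) (ae_of_all _ fun t => ?_)
  exact (M.le_opNorm₂ _ _).trans_eq (mul_assoc _ _ _)

theorem integrable_fun_sub {f g : ℝ → ℝ} (hf : Integrable f (timeMeasure T))
    (hg : Integrable g (timeMeasure T)) : Integrable (fun t => f t - g t) (timeMeasure T) :=
  hf.sub hg

theorem memL2_fluidContent (c₀ : ℝ) (hu : MemL2Time T u) (hp : MemL2Time T p) :
    MemL2Time T (fun t => fluidContent c₀ (u t) (p t)) :=
  ((hp.clm_comp (val Ω)).const_smul c₀).add (hu.clm_comp (dvg Ω))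

/-- `toDual` as a bounded linear map. -/
noncomputable def toDualL (Ω : Set E3) : L2 Ω →L[ℝ] StrongDual ℝ (H10 Ω) :=
  (ContinuousLinearMap.precomp ℝ (val Ω)).comp (innerSL ℝ)

theorem toDualL_apply (f : L2 Ω) : toDualL Ω f = toDual f := rfl

theorem toDual_apply (f : L2 Ω) (r : H10 Ω) : toDual f r = inner ℝ f (val Ω r) := rfl

/-- Two displacements with the same body force differ by the displacement caused by the difference
of the pressures. -/
theorem IsWeakSolution.ae_sub_eq_solveElast (hΩ : Bornology.IsBounded Ω)
    (h₁ : IsWeakSolution T c₀ k F S d₀ u p) (h₂ : IsWeakSolution T c₀ k F S d₀ v q) :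
    ∀ᵐ t ∂timeMeasure T, v t - u t = solveElast hΩ (val Ω (q t - p t)) := by
  have hP : MemL2Time T (fun t => q t - p t) := h₂.memL2_p.sub h₁.memL2_p
  -- The residual serves as its own test function: its elastic energy integrates to zero, and
  -- coercivity forces it to vanish.
  set W : ℝ → H10Vec Ω := fun t => v t - u t - solveElast hΩ (val Ω (q t - p t)) with hWdef
  have hW : MemL2Time T W :=
    (h₂.memL2_u.sub h₁.memL2_u).sub ((hP.clm_comp (val Ω)).clm_comp (solveElast hΩ))
  have hE : ∀ {w : ℝ → H10Vec Ω}, MemL2Time T w →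
      Integrable (fun t => elast (w t) (W t)) (timeMeasure T) := fun hw => by
    simpa only [elastL_apply] using hw.integrable_bilin (elastL Ω) hW
  have hD : ∀ {r : ℝ → H10 Ω}, MemL2Time T r →
      Integrable (fun t => inner ℝ (val Ω (r t)) (dvg Ω (W t))) (timeMeasure T) := fun hr =>
    (hr.clm_comp (val Ω)).integrable_bilin (innerSL ℝ) (hW.clm_comp (dvg Ω))
  have heq := (h₂.elasticity W hW).trans (h₁.elasticity W hW).symm
  have hWW : ∫ t, elast (W t) (W t) ∂timeMeasure T = 0 := by
    have e : ∀ t, elast (W t) (W t) = (elast (v t) (W t) - elast (u t) (W t))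
        - (inner ℝ (val Ω (q t)) (dvg Ω (W t)) - inner ℝ (val Ω (p t)) (dvg Ω (W t))) := by
      intro t
      rw [← inner_sub_left, ← map_sub, ← elast_solveElast hΩ]
      simp only [← elastL_apply, ← sub_apply, ← map_sub]
      rfl
    simp only [e]
    rw [integral_sub (integrable_fun_sub (hE h₂.memL2_u) (hE h₁.memL2_u))
      (integrable_fun_sub (hD h₂.memL2_p) (hD h₁.memL2_p)),
      integral_sub (hE h₂.memL2_u) (hE h₁.memL2_u), integral_sub (hD h₂.memL2_p) (hD h₁.memL2_p)]
    linarith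
  obtain ⟨C, hC, hcoer⟩ := elastL_isCoercive hΩ
  have hnn : ∀ t, 0 ≤ elast (W t) (W t) := fun t => by
    rw [← elastL_apply]
    exact le_trans (by positivity) (hcoer (W t))
  have hz := (integral_eq_zero_iff_of_nonneg hnn (hE hW)).1 hWW
  filter_upwards [hz] with t ht
  have h := hcoer (W t)
  rw [elastL_apply, ht, Pi.zero_apply, mul_assoc] at h
  have h0 : W t = 0 := by
    rw [← norm_eq_zero, ← mul_self_eq_zero]
    exact le_antisymm (nonpos_of_mul_nonpos_right h hC) (mul_self_nonneg _)
  exact sub_eq_zero.1 h0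

theorem IsWeakSolution.ae_fluidContent_sub (hΩ : Bornology.IsBounded Ω)
    (h₁ : IsWeakSolution T c₀ k F S d₀ u p) (h₂ : IsWeakSolution T c₀ k F S d₀ v q) :
    ∀ᵐ t ∂timeMeasure T, fluidContent c₀ (v t) (q t) - fluidContent c₀ (u t) (p t)
      = storage hΩ c₀ (val Ω (q t - p t)) := by
  filter_upwards [h₁.ae_sub_eq_solveElast hΩ h₂] with t ht
  rw [storage_apply, ← ht, fluidContent, fluidContent, map_sub, map_sub, smul_sub]
  abel

theorem diffusion_zero_right (z : L2 Ω) (p : H10 Ω) : diffusion k z p 0 = 0 := by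
  have h : ∀ i, ∀ᵐ x ∂volume.restrict Ω, pd Ω i (0 : H10 Ω) x = 0 := fun i => by
    rw [map_zero]
    exact Lp.coeFn_zero _ _ _
  refine integral_eq_zero_of_ae ?_
  filter_upwards [ae_all_iff.2 h] with x hx
  simp only [hx, mul_zero, Finset.sum_const_zero, Pi.zero_apply]

/-- The difference of the pressure equations, tested with the difference of the pressures. -/
theorem IsWeakSolution.ae_pressure_sub (hΩ : Bornology.IsBounded Ω) (hk : Continuous k) {C : ℝ}
    (hC : ∀ x, |k x| ≤ C)
    (h₁ : IsWeakSolution T c₀ k F S d₀ u p) (h₂ : IsWeakSolution T c₀ k F S d₀ v q)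
    {g : ℝ → L2 Ω} (hg : MemL2Time T g)
    (hgd : HasWeakTimeDeriv T (fun t => val Ω (q t - p t)) g) :
    ∀ᵐ t ∂timeMeasure T,
      diffusion k (fluidContent c₀ (v t) (q t)) (q t) (q t - p t)
        - diffusion k (fluidContent c₀ (u t) (p t)) (p t) (q t - p t)
        + inner ℝ (storage hΩ c₀ (g t)) (val Ω (q t - p t)) = 0 := by
  obtain ⟨ζ₁, hζ₁, hd₁, he₁⟩ := h₁.pressure
  obtain ⟨ζ₂, hζ₂, hd₂, he₂⟩ := h₂.pressure
  have hP : MemL2Time T (fun t => q t - p t) := h₂.memL2_p.sub h₁.memL2_p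
  have hz₁ := memL2_fluidContent c₀ h₁.memL2_u h₁.memL2_p
  have hz₂ := memL2_fluidContent c₀ h₂.memL2_u h₂.memL2_p
  -- Uniqueness of weak derivatives in V' replaces the duality pairing by an L² inner product.
  have hζ : ∀ᵐ t ∂timeMeasure T, ζ₂ t - ζ₁ t = toDual (storage hΩ c₀ (g t)) := by
    have hsub := hd₂.sub hd₁ (hz₂.clm_comp (toDualL Ω)).integrable
      (hz₁.clm_comp (toDualL Ω)).integrable hζ₂.integrable hζ₁.integrable
    have hB : HasWeakTimeDeriv T (fun t => toDual (storage hΩ c₀ (val Ω (q t - p t))))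
        (fun t => toDual (storage hΩ c₀ (g t))) :=
      HasWeakTimeDeriv.clm_comp ((toDualL Ω).comp (storage hΩ c₀)) hgd
        (hP.clm_comp (val Ω)).integrable hg.integrable
    refine HasWeakTimeDeriv.unique (hζ₂.integrable.sub hζ₁.integrable)
      (hg.clm_comp ((toDualL Ω).comp (storage hΩ c₀))).integrable
      (hsub.congr ?_) hB
    filter_upwards [h₁.ae_fluidContent_sub hΩ h₂] with t ht
    rw [← ht, ← toDualL_apply, ← toDualL_apply, ← toDualL_apply, map_sub]
  have i₁ := integrable_diffusion hk hC hz₁ h₁.memL2_p hP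
  have i₂ := integrable_diffusion hk hC hz₂ h₂.memL2_p hP
  have j₁ := hζ₁.integrable_bilin (ContinuousLinearMap.id ℝ (StrongDual ℝ (H10 Ω))) hP
  have j₂ := hζ₂.integrable_bilin (ContinuousLinearMap.id ℝ (StrongDual ℝ (H10 Ω))) hP
  simp only [ContinuousLinearMap.id_apply] at j₁ j₂
  have hsum := (i₂.sub i₁).add (j₂.sub j₁)
  -- Cutting the test function off to an arbitrary measurable set of times turns the integrated
  -- identity into a pointwise one.
  have hzero := hsum.ae_eq_zero_of_forall_setIntegral_eq_zero fun s hs _ => by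
    have hr : MemL2Time T (s.indicator fun t => q t - p t) := hP.indicator hs
    have heq := (he₂ _ hr).trans (he₁ _ hr).symm
    have ediff : ∀ (z : ℝ → L2 Ω) (r : ℝ → H10 Ω), (fun t => diffusion k (z t) (r t)
        (s.indicator (fun t => q t - p t) t))
        = s.indicator fun t => diffusion k (z t) (r t) (q t - p t) := by
      intro z r
      funext t
      by_cases ht : t ∈ s
      · simp [ht]
      · simp [ht, diffusion_zero_right]
    have edual : ∀ ζ : ℝ → StrongDual ℝ (H10 Ω), (fun t => ζ t
        (s.indicator (fun t => q t - p t) t)) = s.indicator fun t => ζ t (q t - p t) := by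
      intro ζ
      funext t
      by_cases ht : t ∈ s <;> simp [ht]
    rw [ediff, ediff, edual, edual] at heq
    simp only [integral_indicator hs] at heq
    simp only [Pi.add_apply, Pi.sub_apply]
    rw [integral_add (integrable_fun_sub i₂ i₁).integrableOn (integrable_fun_sub j₂ j₁).integrableOn,
      integral_sub i₂.integrableOn i₁.integrableOn, integral_sub j₂.integrableOn j₁.integrableOn]
    linarith
  filter_upwards [hzero, hζ] with t ht ht'
  rw [← toDual_apply, ← ht']
  exact ht

/-- The initial energy of the difference of two solutions vanishes. -/
theorem IsWeakSolution.inner_storage_initial_eq_zero (hΩ : Bornology.IsBounded Ω) (hT : 0 < T)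
    (h₁ : IsWeakSolution T c₀ k F S d₀ u p) (h₂ : IsWeakSolution T c₀ k F S d₀ v q)
    {f : ℝ → L2 Ω} (hf : ContinuousOn f (Icc 0 T))
    (hfP : ∀ᵐ t ∂timeMeasure T, val Ω (q t - p t) = f t) :
    inner ℝ (storage hΩ c₀ (f 0)) (f 0) = 0 := by
  have ext : ∀ {a b : ℝ → ℝ}, ContinuousOn a (Icc 0 T) → ContinuousOn b (Icc 0 T) →
      (∀ᵐ t ∂timeMeasure T, a t = b t) → a 0 = b 0 := fun ha hb hab =>
    Measure.eqOn_Icc_of_ae_eq volume hT.ne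
      (by rw [EventuallyEq, restrict_Ioo_eq_restrict_Icc.symm]; exact hab) ha hb
      (left_mem_Icc.2 hT.le)
  -- For both solutions the representative of (ζ(t), r) starts at (d₀, r), so the difference starts
  -- at zero.
  have horth : ∀ r : H10 Ω, inner ℝ (storage hΩ c₀ (f 0)) (val Ω r) = 0 := by
    intro r
    obtain ⟨g₁, ac₁, ae₁, e₁⟩ := h₁.initial r
    obtain ⟨g₂, ac₂, ae₂, e₂⟩ := h₂.initial r
    have hcont := (ac₂.fun_sub ac₁).continuousOn
    rw [uIcc_of_le hT.le] at hcont
    have := ext (a := fun t => inner ℝ (storage hΩ c₀ (f t)) (val Ω r)) (by fun_prop) hcont (by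
      filter_upwards [ae₁, ae₂, hfP, h₁.ae_fluidContent_sub hΩ h₂] with t a1 a2 a3 a4
      rw [a1, a2, ← inner_sub_left, a4, a3])
    rw [this, e₁, e₂, sub_self]
  -- It is not known that f(0) comes from H¹₀(Ω), but f(t) does for almost every t; continuity
  -- carries the orthogonality to t = 0.
  refine ext (a := fun t => inner ℝ (storage hΩ c₀ (f 0)) (f t)) (b := fun _ => 0)
    (by fun_prop) continuousOn_const ?_
  filter_upwards [hfP] with t ht
  rw [← ht]
  exact horth _

theorem ae_unique (hΩ : Bornology.IsBounded Ω) (hT : 0 < T) (hc₀ : 0 ≤ c₀)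
    (hk : PermeabilityBounds k) {L : ℝ≥0} (hL : LipschitzWith L k)
    (hup : (u, p) ∈ classW T c₀ k F S d₀) (hvq : (v, q) ∈ classW T c₀ k F S d₀)
    (hp : MemL2W1Inf T p) : ∀ᵐ t ∂timeMeasure T, v t = u t ∧ q t = p t := by
  obtain ⟨h₁, g₁, hg₁, hd₁⟩ := hup
  obtain ⟨h₂, g₂, hg₂, hd₂⟩ := hvq
  obtain ⟨hkc, κ, C, hκ, -, hkb⟩ := hk
  have hC : ∀ x, |k x| ≤ C := fun x => by
    rw [abs_of_nonneg (hκ.le.trans (hkb x).1)]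
    exact (hkb x).2
  simp only at h₁ h₂ hd₁ hd₂
  have hP : MemL2Time T (fun t => q t - p t) := h₂.memL2_p.sub h₁.memL2_p
  have hf := (hP.clm_comp (val Ω)).integrable
  set g : ℝ → L2 Ω := fun t => g₂ t - g₁ t
  have hg : MemL2Time T g := hg₂.sub hg₁
  have hgd : HasWeakTimeDeriv T (fun t => val Ω (q t - p t)) g := by
    simp only [map_sub]
    exact hd₂.sub hd₁ (h₂.memL2_p.clm_comp _).integrable (h₁.memL2_p.clm_comp _).integrable
      hg₂.integrable hg₁.integrable
  obtain ⟨c, hc⟩ := hgd.exists_ae_eq_primitive hT hf hg.integrable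
  have hgi := (integrable_timeMeasure_iff hT.le).1 hg.integrable
  set f : ℝ → L2 Ω := fun t => c + ∫ s in (0)..t, g s with hfdef
  have hfcont : ContinuousOn f (Icc 0 T) := by
    have := (hgi.absolutelyContinuousOnInterval_primitive.const_add c).continuousOn
    rwa [uIcc_of_le hT.le] at this
  let M : L2 Ω →L[ℝ] L2 Ω →L[ℝ] ℝ :=
    (innerSL ℝ).bilinearComp (storage hΩ c₀) (ContinuousLinearMap.id ℝ (L2 Ω))
  have hM : ∀ x y, M x y = inner ℝ (storage hΩ c₀ x) y := fun x y => rfl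
  have hMnn : ∀ x, 0 ≤ M x x := fun x => by
    have h := (sq_nonneg _).trans (norm_storage_sq_le hΩ hc₀ x)
    rw [hM]
    exact nonneg_of_mul_nonneg_right h (by positivity)
  have hsub : ∀ t ∈ Icc 0 T, uIcc 0 t ⊆ uIcc 0 T := fun t ht =>
    uIcc_subset_uIcc left_mem_uIcc (by rwa [uIcc_of_le hT.le])
  have h0 : M c c = 0 := by
    have := h₁.inner_storage_initial_eq_zero hΩ hT h₂ hfcont hc
    simpa only [hfdef, intervalIntegral.integral_same, add_zero, ← hM] using this
  have energy : ∀ t ∈ Icc 0 T, 2 * ∫ s in (0)..t, M (g s) (f s) = M (f t) (f t) := by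
    intro t ht
    have := integral_symm_bilin_primitive M (inner_storage_comm hΩ c₀)
      (hgi.mono_set (hsub t ht)) c
    rw [h0, sub_zero] at this
    exact this
  have hgf : IntervalIntegrable (fun s => M (g s) (f s)) volume 0 T :=
    hgi.bilin_continuousOn M (by rwa [uIcc_of_le hT.le])
  set N : ℝ → ℝ := fun t => (w1InfNorm (p t)).toReal
  -- The product of the constants of `le_diffusion_sub_diffusion` and `norm_storage_sq_le`.
  set K : ℝ := 3 * (L ^ 2 / (2 * κ)) * (2 * (c₀ + 1))
  have hK : 0 ≤ K := by positivity
  have hNi : IntervalIntegrable (fun t => 2 * K * N t ^ 2) volume 0 T := by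
    rw [← integrable_timeMeasure_iff hT.le]
    exact hp.2.integrable_sq.const_mul _
  have hEcont : ContinuousOn (fun t => M (f t) (f t)) (Icc 0 T) := by fun_prop
  have hNE : IntervalIntegrable (fun t => 2 * K * N t ^ 2 * M (f t) (f t)) volume 0 T :=
    hNi.mul_continuousOn (by rwa [uIcc_of_le hT.le])
  have main : ∀ᵐ t ∂timeMeasure T, κ / 2 * ∑ i, ‖pd Ω i (q t - p t)‖ ^ 2
      + M (g t) (f t) ≤ K * N t ^ 2 * M (f t) (f t) := by
    filter_upwards [h₁.ae_pressure_sub hΩ hkc hC h₂ hg hgd, hc, hp.1,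
      h₁.ae_fluidContent_sub hΩ h₂] with t a1 a2 a3 a4
    have b1 := le_diffusion_sub_diffusion hkc hC hκ (fun x => (hkb x).1) hL
      (fluidContent c₀ (v t) (q t)) (fluidContent c₀ (u t) (p t)) (q t) a3
    rw [a4, a2] at b1
    rw [a2, ← hM] at a1
    have b2 := mul_le_mul_of_nonneg_left (norm_storage_sq_le hΩ hc₀ (f t))
      (by positivity : 0 ≤ 3 * ((L : ℝ) ^ 2 / (2 * κ)) * N t ^ 2)
    have b3 : 3 * ((L : ℝ) ^ 2 / (2 * κ)) * N t ^ 2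
        * (2 * (c₀ + 1) * inner ℝ (storage hΩ c₀ (f t)) (f t)) = K * N t ^ 2 * M (f t) (f t) := by
      simp only [K, hM]
      ring
    rw [b3] at b2
    linarith
  have hE0 : ∀ t ∈ Icc 0 T, M (f t) (f t) = 0 := by
    refine eq_zero_of_le_integral_mul hT.le hEcont (fun t _ => hMnn _) hNi
      (fun t => by positivity) fun t ht => ?_
    rw [← energy t ht, ← intervalIntegral.integral_const_mul]
    refine intervalIntegral.integral_mono_ae_restrict ht.1
      ((hgf.mono_set (hsub t ht)).const_mul 2) (hNE.mono_set (hsub t ht)) ?_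
    rw [← restrict_Ioo_eq_restrict_Icc]
    have hmono := ae_restrict_of_ae_restrict_of_subset (Ioo_subset_Ioo_right ht.2) main
    filter_upwards [hmono] with s hs
    have : 0 ≤ κ / 2 * ∑ i, ‖pd Ω i (q s - p s)‖ ^ 2 := by positivity
    linarith
  have hgrad_int : Integrable (fun t => κ / 2 * ∑ i, ‖pd Ω i (q t - p t)‖ ^ 2) (timeMeasure T) :=
    (integrable_finsetSum _ fun i _ => ((hP.clm_comp (pd Ω i)).norm.integrable_sq)).const_mul _
  have hgrad_nn : ∀ t, 0 ≤ κ / 2 * ∑ i, ‖pd Ω i (q t - p t)‖ ^ 2 := fun t => by positivity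
  -- Zero energy alone need not give P = 0 if c₀ = 0. The gradient term does: its integral is at
  -- most −∫M(g, f), which is minus half the final energy and hence zero.
  have hgrad : ∫ t, κ / 2 * ∑ i, ‖pd Ω i (q t - p t)‖ ^ 2 ∂timeMeasure T = 0 := by
    refine le_antisymm ?_ (integral_nonneg hgrad_nn)
    have hle : ∫ t, κ / 2 * ∑ i, ‖pd Ω i (q t - p t)‖ ^ 2 ∂timeMeasure T
        ≤ ∫ t, -M (g t) (f t) ∂timeMeasure T := by
      refine integral_mono_ae hgrad_int ((integrable_timeMeasure_iff hT.le).2 hgf).neg ?_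
      filter_upwards [main, ae_restrict_mem measurableSet_Ioo] with t ht htm
      rw [hE0 t (Ioo_subset_Icc_self htm), mul_zero] at ht
      linarith
    have hT' := energy T (right_mem_Icc.2 hT.le)
    rw [hE0 T (right_mem_Icc.2 hT.le)] at hT'
    rw [integral_neg, integral_timeMeasure_eq (fun t => M (g t) (f t)) hT.le] at hle
    linarith
  obtain ⟨C', -, hC'⟩ := H10.exists_norm_sq_le hΩ
  filter_upwards [(integral_eq_zero_iff_of_nonneg hgrad_nn hgrad_int).1 hgrad,
    h₁.ae_sub_eq_solveElast hΩ h₂] with t ht hU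
  have hs : ∑ i, ‖pd Ω i (q t - p t)‖ ^ 2 = 0 :=
    (mul_eq_zero.1 ht).resolve_left (by positivity)
  have hPt : q t - p t = 0 := by
    have := hC' (q t - p t)
    rw [hs, mul_zero] at this
    rw [← norm_eq_zero, ← sq_eq_zero_iff]
    exact le_antisymm this (sq_nonneg _)
  rw [hPt, map_zero, map_zero] at hU
  exact ⟨sub_eq_zero.1 hU, sub_eq_zero.1 hPt⟩

end Uniqueness

end Biot

theorem theorem2p3 (Ω : Set E3) (hΩ : IsC2Domain Ω) (T : ℝ) (hT : 0 < T)
    (c₀ : ℝ) (hc₀ : 0 ≤ c₀)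
    (k : ℝ → ℝ) (hk : PermeabilityBounds k) (hkLip : ∃ L : ℝ≥0, LipschitzWith L k)
    (F : ℝ → L2Vec Ω) (hF : MemL2Time T F) (hF' : MemH1Time T (fun t => toDualVec (F t)))
    (S : ℝ → StrongDual ℝ (H10 Ω)) (hS : MemL2Time T S)
    (d₀ : L2 Ω)
    (u : ℝ → H10Vec Ω) (p : ℝ → H10 Ω) (hup : (u, p) ∈ classW T c₀ k F S d₀)
    (hp : MemL2W1Inf T p)
    (hcase : (∃ (u₀ : H10Vec Ω) (p₀ : L2 Ω), d₀ = dvg Ω u₀ + c₀ • p₀) ∨ 0 < c₀) :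
    ∀ v q, (v, q) ∈ classW T c₀ k F S d₀ →
      ∀ᵐ t ∂timeMeasure T, v t = u t ∧ q t = p t := by
  obtain ⟨L, hL⟩ := hkLip
  exact fun v q hvq => ae_unique hΩ.isBounded hT hc₀ hk hL hup hvq hp
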